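/- **Setting.** Let $X$ be a compact smooth Riemannian manifold of dimension $n$, $Y$ a (second countable, Hausdorff) smooth Riemannian manifold of dimension $n+1$, $\imath:X\hookrightarrow Y$ a smooth Riemannian embedding and $\nu$ a smooth unit normal vector field along $\imath$. Put $\tilde\imath(x,s)=\exp_{\imath(x)}(s\nu_x)$, and let $\varepsilon_0>0$ be such that $\tilde\imath$ is defined on $X\times(-\varepsilon_0,\varepsilon_0)$ and is a diffeomorphism of it onto an open subset of $Y$. Let $\Lambda$ be the positive function on $X\times(-\varepsilon_0,\varepsilon_0)$ given by the ratio of the Riemannian volume of the product metric $g_X+ds^2$ to that of $\tilde\imath^*g_Y$; in coordinates $(x,s)$, $\Lambda=\sqrt{\det g_X(x)/\det(\tilde\imath^*g_Y)(x,s)}$. Let $\mathrm{Cl}_1=\mathbb C\oplus\mathbb C\sigma_1$ be the graded C*-algebra with odd generator $\sigma_1=\sigma_1^*$, $\sigma_1^2=1$; the algebra $C_0(Y)\otimes\mathrm{Cl}_1=C_0(Y,\mathrm{Cl}_1)$ is graded by $\mathrm{Cl}_1$, and $C(X)$ is trivially graded. Fix $\varepsilon\in(0,\varepsilon_0)$.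 Let $\mathcal E=C_0(X\times(-\varepsilon,\varepsilon),\mathrm{Cl}_1)$, graded by $\mathrm{Cl}_1$, with $$(g\psi h)(x,s)=g(x)\,\psi(x,s)\,h(\tilde\imath(x,s))\qquad(g\in C(X),\ h\in C_0(Y)\otimes\mathrm{Cl}_1),$$ $$\langle\psi,\phi\rangle(\tilde\imath(x,s))=\Lambda(x,s)\,\psi(x,s)^*\phi(x,s)\quad(|s|<\varepsilon),\qquad \langle\psi,\phi\rangle=0\ \text{ elsewhere on } Y,$$ and let $(S\psi)(x,s)=f(s)\,\sigma_1\psi(x,s)$ with $f(s)=-\frac{\pi}{2\varepsilon}\tan\!\big(\frac{\pi s}{2\varepsilon}\big)$ on the domain $\{\psi\in\mathcal E: S\psi\in\mathcal E\}$. **Shriek class.** Let $r\in(0,\varepsilon_0)$ and let $\chi:[-r,r]\to\mathbb R$ be continuous with $\chi(\pm r)=\pm1$. The class $\imath_!\in KK(C(X),C_0(Y)\otimes\mathrm{Cl}_1)$ is the push-forward along the open embedding $\tilde\imath|_{X\times(-r,r)}$ of the Thom class of the normal bundle: it is the class of the bounded cycle consisting of the module $C_0(X\times(-r,r),\mathrm{Cl}_1)$,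 with the same formulas for the bimodule structure and with $\Lambda$ replaced by $1$ in the inner product, and of the operator of multiplication by $-\chi(s)\sigma_1$. **Proposition.** 1. $\mathcal E$ is a well-defined, complete, countably generated graded Hilbert $C(X)$-$C_0(Y)\otimes\mathrm{Cl}_1$-bimodule, and $S$ is self-adjoint and regular and has compact resolvents $(S\pm i)^{-1}$. 2. $\imath_!^\varepsilon=(\mathcal E,S)$ is an unbounded $KK$-cycle from $C(X)$ to $C_0(Y)\otimes\mathrm{Cl}_1$. 3. $\imath_!^\varepsilon$ represents $\imath_!$: the bounded transform $S(1+S^2)^{-1/2}$ makes $\mathcal E$ a bounded $KK$-cycle, and for every $r\in(0,\varepsilon_0)$ and every $\chi$ as above the displayed data for $\imath_!$ form a bounded $KK$-cycle, which is homotopic to $(\mathcal E,S(1+S^2)^{-1/2})$ through a bounded $KK$-cycle from $C(X)$ to $C([0,1],C_0(Y)\otimes\mathrm{Cl}_1)$. -/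

import Mathlib

open scoped ContDiff Manifold ZeroAtInfty

/-! ### The complex Clifford algebra on one generator -/

/-- The complex Clifford algebra on one self-adjoint generator `σ` with `σ ^ 2 = 1`, as a
C⋆-algebra: the element `a + b σ` is the pair `(a + b, a - b)`. -/
abbrev Cl1 : Type := ℂ × ℂ

namespace Cl1

/-- The odd generator. -/
def σ : Cl1 := (1, -1)

/-- The grading automorphism `a + b σ ↦ a - b σ`. -/
def grade : Cl1 →⋆ₐ[ℂ] Cl1 where
  toFun := Prod.swap
  map_one' := rfl
  map_mul' _ _ := rfl
  map_zero' := rfl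
  map_add' _ _ := rfl
  commutes' _ := rfl
  map_star' _ := rfl

theorem grade_grade (z : Cl1) : grade (grade z) = z := rfl

theorem σ_mul_σ : σ * σ = 1 := by simp [σ]

theorem star_σ : star σ = σ := by ext <;> simp [σ]

theorem grade_apply (z : Cl1) : grade z = (z.2, z.1) := rfl

theorem grade_σ : grade σ = -σ := by ext <;> simp [σ, grade_apply]

theorem existsUnique_eq_add (z : Cl1) :
    ∃! c : ℂ × ℂ, z = algebraMap ℂ Cl1 c.1 + c.2 • σ := by
  refine ⟨((z.1 + z.2) / 2, (z.1 - z.2) / 2), ?_, ?_⟩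
  · ext <;> simp [σ] <;> ring
  · rintro ⟨a, b⟩ rfl
    ext
    · simp [σ]
      ring
    · simp [σ]

theorem continuous_grade : Continuous grade := continuous_swap

end Cl1

/-! ### Graded C⋆-algebras -/

/-- A grading of a C⋆-algebra: an involutive `*`-automorphism. -/
structure CStarGrading (A : Type*) [NonUnitalCStarAlgebra A] where
  hom : A →⋆ₙₐ[ℂ] A
  hom_hom : ∀ a, hom (hom a) = a

namespace CStarGrading

/-- The trivial grading. -/
def trivial (A : Type*) [NonUnitalCStarAlgebra A] : CStarGrading A where
  hom := NonUnitalStarAlgHom.id ℂ A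
  hom_hom _ := rfl

theorem continuous_hom {A : Type*} [NonUnitalCStarAlgebra A] (α : CStarGrading A) :
    Continuous α.hom :=
  (NonUnitalStarAlgHom.isometry α.hom
    (Function.LeftInverse.injective (g := α.hom) α.hom_hom)).continuous

/-- The pointwise grading of `C([0,1], B)`. -/
noncomputable def cylinder {B : Type*} [NonUnitalCStarAlgebra B] (β : CStarGrading B) :
    CStarGrading C(unitInterval, B) where
  hom :=
    { toFun := fun f => ⟨fun t => β.hom (f t), β.continuous_hom.comp f.continuous⟩
      map_smul' := fun c f => by ext t; simp
      map_zero' := by ext t; simp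
      map_add' := fun f g => by ext t; simp
      map_mul' := fun f g => by ext t; simp
      map_star' := fun f => by ext t; simp [map_star] }
  hom_hom f := by ext t; exact β.hom_hom (f t)

/-- The grading of `C₀(Y) ⊗ Cl₁ = C₀(Y, Cl₁)` coming from `Cl₁`. -/
noncomputable def c0Cl1 (Y : Type*) [TopologicalSpace Y] : CStarGrading C₀(Y, Cl1) where
  hom :=
    { toFun := fun f =>
        ⟨⟨fun y => Cl1.grade (f y), Cl1.continuous_grade.comp f.continuous⟩, by
          have h := (Cl1.continuous_grade.tendsto 0).comp f.zero_at_infty'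
          rw [map_zero] at h
          exact h⟩
      map_smul' := fun c f => by ext y <;> simp [Cl1.grade_apply]
      map_zero' := by ext y <;> simp [Cl1.grade_apply]
      map_add' := fun f g => by ext y <;> simp [Cl1.grade_apply]
      map_mul' := fun f g => by ext y <;> simp [Cl1.grade_apply]
      map_star' := fun f => by ext y <;> simp [Cl1.grade_apply] }
  hom_hom f := by ext y <;> rfl

end CStarGrading

/-! ### Graded Hilbert bimodules, unbounded and bounded `KK`-cycles -/

/-- The structure of a countably generated graded Hilbert `A`-`B`-bimodule on the complex vector
space `E`: a right action of `B`, a `B`-valued inner product (linear in the second variable) for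
which `E` is complete, a grading, and an even left action of `A` by adjointable operators. -/
structure GradedBimodule {A B : Type*} [NonUnitalCStarAlgebra A] [NonUnitalCStarAlgebra B]
    (α : CStarGrading A) (β : CStarGrading B) (E : Type*) [AddCommGroup E] [Module ℂ E] where
  /-- The right action `act x b = x b`. -/
  act : E →ₗ[ℂ] B →ₗ[ℂ] E
  act_mul : ∀ x b c, act x (b * c) = act (act x b) c
  /-- The inner product. -/
  inner : E → E → B
  inner_add_right : ∀ x y z, inner x (y + z) = inner x y + inner x z
  inner_smul_right : ∀ (c : ℂ) x y, inner x (c • y) = c • inner x y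
  inner_act_right : ∀ x y b, inner x (act y b) = inner x y * b
  star_inner : ∀ x y, star (inner x y) = inner y x
  inner_self_nonneg : ∀ x, ∃ b, inner x x = star b * b
  inner_self_eq_zero : ∀ x, inner x x = 0 → x = 0
  complete : ∀ u : ℕ → E,
    (∀ δ > 0, ∃ N, ∀ m ≥ N, ∀ k ≥ N, √‖inner (u m - u k) (u m - u k)‖ < δ) →
    ∃ x, ∀ δ > 0, ∃ N, ∀ m ≥ N, √‖inner (u m - x) (u m - x)‖ < δ
  countably_generated : ∃ e : ℕ → E, ∀ x, ∀ δ > 0, ∃ (N : ℕ) (b : ℕ → B),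
    √‖inner (x - ∑ i ∈ Finset.range N, act (e i) (b i))
        (x - ∑ i ∈ Finset.range N, act (e i) (b i))‖ < δ
  /-- The grading operator. -/
  grade : E →ₗ[ℂ] E
  grade_grade : ∀ x, grade (grade x) = x
  grade_act : ∀ x b, grade (act x b) = act (grade x) (β.hom b)
  inner_grade : ∀ x y, inner (grade x) (grade y) = β.hom (inner x y)
  /-- The left action. -/
  left : A →ₙₐ[ℂ] Module.End ℂ E
  inner_left : ∀ a x y, inner (left a x) y = inner x (left (star a) y)
  grade_left : ∀ a x, grade (left a x) = left (α.hom a) (grade x)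

namespace GradedBimodule

variable {A B : Type*} [NonUnitalCStarAlgebra A] [NonUnitalCStarAlgebra B]
  {α : CStarGrading A} {β : CStarGrading B} {E : Type*} [AddCommGroup E] [Module ℂ E]

/-- The Hilbert module norm `‖⟨x, x⟩‖^(1/2)`. -/
noncomputable def norm (M : GradedBimodule α β E) (x : E) : ℝ := √‖M.inner x x‖

/-- `T'` is the adjoint of the everywhere defined operator `T`. -/
def IsAdjointPair (M : GradedBimodule α β E) (T T' : E →ₗ[ℂ] E) : Prop :=
  ∀ x y, M.inner (T x) y = M.inner x (T' y)

/-- Compact operators: norm limits of finite sums of the operators `z ↦ x ⟨y, z⟩`. -/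
def IsCompactOp (M : GradedBimodule α β E) (T : E →ₗ[ℂ] E) : Prop :=
  ∀ δ > 0, ∃ (N : ℕ) (x y : ℕ → E), ∀ z,
    M.norm (T z - ∑ i ∈ Finset.range N, M.act (x i) (M.inner (y i) z)) ≤ δ * M.norm z

/-- A set of vectors is dense for the Hilbert module norm. -/
def IsDense (M : GradedBimodule α β E) (s : Set E) : Prop :=
  ∀ x, ∀ δ > 0, ∃ y ∈ s, M.norm (x - y) < δ

/-- `y` is in the domain of the adjoint `S*` of `S`, and `S* y = z`. -/
def AdjointAt (M : GradedBimodule α β E) (S : E →ₗ.[ℂ] E) (y z : E) : Prop :=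
  ∀ x : S.domain, M.inner (S x) y = M.inner (x : E) z

/-- `S` is densely defined and equal to its adjoint, domains included. -/
def IsSelfAdjointOp (M : GradedBimodule α β E) (S : E →ₗ.[ℂ] E) : Prop :=
  M.IsDense (S.domain : Set E) ∧
    ∀ y z, M.AdjointAt S y z ↔ ∃ h : y ∈ S.domain, S ⟨y, h⟩ = z

/-- Regular operators: `S` is `B`-linear, densely defined and closed, `S*` is densely defined,
and `1 + S* S` has dense range. -/
structure IsRegularOp (M : GradedBimodule α β E) (S : E →ₗ.[ℂ] E) : Prop where
  act_mem : ∀ (x : S.domain) (b : B), ∃ h : M.act (x : E) b ∈ S.domain,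
    S ⟨M.act (x : E) b, h⟩ = M.act (S x) b
  dense_domain : M.IsDense (S.domain : Set E)
  closed : ∀ x y : E,
    (∀ δ > 0, ∃ u : S.domain, M.norm ((u : E) - x) < δ ∧ M.norm (S u - y) < δ) →
    ∃ h : x ∈ S.domain, S ⟨x, h⟩ = y
  dense_adjoint : M.IsDense {y | ∃ z, M.AdjointAt S y z}
  dense_range : M.IsDense {v | ∃ (x : S.domain) (z : E), M.AdjointAt S (S x) z ∧ v = (x : E) + z}

/-- `R` is the everywhere defined inverse `(S + c)⁻¹`. -/
def IsResolvent (S : E →ₗ.[ℂ] E) (c : ℂ) (R : E →ₗ[ℂ] E) : Prop :=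
  (∀ x, ∃ h : R x ∈ S.domain, S ⟨R x, h⟩ + c • R x = x) ∧
    ∀ x : S.domain, R (S x + c • (x : E)) = x

/-- `(S ± i)⁻¹` exist and are compact operators. -/
def HasCompactResolvent (M : GradedBimodule α β E) (S : E →ₗ.[ℂ] E) : Prop :=
  ∀ c : ℂ, c = Complex.I ∨ c = -Complex.I →
    ∃ R : E →ₗ[ℂ] E, IsResolvent S c R ∧ M.IsCompactOp R

/-- `(E, S)` is an unbounded `KK`-cycle from `A` to `B`. -/
structure IsUnboundedKKCycle (M : GradedBimodule α β E) (S : E →ₗ.[ℂ] E) : Prop where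
  selfAdjoint : M.IsSelfAdjointOp S
  regular : M.IsRegularOp S
  odd : ∀ x : S.domain, ∃ h : M.grade (x : E) ∈ S.domain,
    S ⟨M.grade (x : E), h⟩ = -M.grade (S x)
  /-- A dense set of elements of `A` preserves the domain and has graded commutator with `S` that
  extends to an adjointable operator. -/
  bounded_commutators : ∀ a : A, ∀ δ > 0, ∃ a' : A, ‖a - a'‖ < δ ∧
    ∃ T T' : E →ₗ[ℂ] E, M.IsAdjointPair T T' ∧
      ∀ x : S.domain, ∃ h : M.left a' (x : E) ∈ S.domain,
        S ⟨M.left a' (x : E), h⟩ - M.left (α.hom a') (S x) = T x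
  locally_compact_resolvent : ∀ c : ℂ, c = Complex.I ∨ c = -Complex.I →
    ∃ R : E →ₗ[ℂ] E, IsResolvent S c R ∧ ∀ a : A, M.IsCompactOp (M.left a * R)

/-- `(E, F)` is a bounded `KK`-cycle (a Kasparov module) from `A` to `B`. -/
structure IsBoundedKKCycle (M : GradedBimodule α β E) (F : E →ₗ[ℂ] E) : Prop where
  odd : ∀ x, F (M.grade x) = -M.grade (F x)
  adjoint : ∃ F' : E →ₗ[ℂ] E, M.IsAdjointPair F F' ∧ ∀ a, M.IsCompactOp (M.left a * (F - F'))
  square : ∀ a, M.IsCompactOp (M.left a * (F * F - 1))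
  commutator : ∀ a, M.IsCompactOp (F * M.left a - M.left (α.hom a) * F)

/-- `F` is the bounded transform `S (1 + S ^ 2)^(-1/2)` of the self-adjoint operator `S`; the
operator `R` below is the positive square root of `(1 + S ^ 2)⁻¹`. -/
def IsBoundedTransform (M : GradedBimodule α β E) (S : E →ₗ.[ℂ] E) (F : E →ₗ[ℂ] E) : Prop :=
  ∃ R : E →ₗ[ℂ] E,
    (∀ x, ∃ b, M.inner x (R x) = star b * b) ∧
    (∀ x, ∃ (h : R (R x) ∈ S.domain) (h' : S ⟨R (R x), h⟩ ∈ S.domain),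
      R (R x) + S ⟨S ⟨R (R x), h⟩, h'⟩ = x) ∧
    ∀ x, ∃ h : R x ∈ S.domain, F x = S ⟨R x, h⟩

/-- The pair `(M₀, F₀)` over `B` is the evaluation at `t`, i.e. the tensor product along the
evaluation homomorphism `C([0,1], B) → B` at `t`, of the pair `(M, F)` over `C([0,1], B)`. -/
def IsEvaluation {H : Type*} [AddCommGroup H] [Module ℂ H]
    (M : GradedBimodule α β.cylinder H) (F : H →ₗ[ℂ] H) (t : unitInterval)
    (M₀ : GradedBimodule α β E) (F₀ : E →ₗ[ℂ] E) : Prop :=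
  ∃ ev : H →ₗ[ℂ] E, Function.Surjective ev ∧
    (∀ x y, M₀.inner (ev x) (ev y) = M.inner x y t) ∧
    (∀ x (b : C(unitInterval, B)), ev (M.act x b) = M₀.act (ev x) (b t)) ∧
    (∀ a x, ev (M.left a x) = M₀.left a (ev x)) ∧
    (∀ x, ev (M.grade x) = M₀.grade (ev x)) ∧
    ∀ x, ev (F x) = F₀ (ev x)

end GradedBimodule

/-- Equality of classes in `KK(A, B)`: the two bounded cycles are the end points of a homotopy,
which is a bounded cycle from `A` to `C([0,1], B)`. -/
def SameKKClass.{u} {A B : Type*} [NonUnitalCStarAlgebra A] [NonUnitalCStarAlgebra B]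
    {α : CStarGrading A} {β : CStarGrading B} {E₀ E₁ : Type u}
    [AddCommGroup E₀] [Module ℂ E₀] [AddCommGroup E₁] [Module ℂ E₁]
    (M₀ : GradedBimodule α β E₀) (F₀ : E₀ →ₗ[ℂ] E₀)
    (M₁ : GradedBimodule α β E₁) (F₁ : E₁ →ₗ[ℂ] E₁) : Prop :=
  ∃ (H : Type u) (_ : AddCommGroup H) (_ : Module ℂ H)
    (M : GradedBimodule α β.cylinder H) (F : H →ₗ[ℂ] H),
    M.IsBoundedKKCycle F ∧ M.IsEvaluation F 0 M₀ F₀ ∧ M.IsEvaluation F 1 M₁ F₁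

/-! ### Riemannian geometry of the embedding -/

/-- Smooth Riemannian metrics on the `m`-dimensional manifold `M`. -/
abbrev RiemMetric (m : ℕ) (M : Type*) [TopologicalSpace M]
    [ChartedSpace (EuclideanSpace ℝ (Fin m)) M] [IsManifold (𝓡 m) ∞ M] :=
  Bundle.ContMDiffRiemannianMetric (𝓡 m) ∞ (EuclideanSpace ℝ (Fin m))
    (fun x : M => TangentSpace (𝓡 m) x)

section Geodesics

variable {m : ℕ} {M : Type*} [TopologicalSpace M] [ChartedSpace (EuclideanSpace ℝ (Fin m)) M]
  [IsManifold (𝓡 m) ∞ M]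

/-- The metric in the chart around `p`: `metricInChart g p u v w = g_{ij}(u) v^i w^j`. -/
noncomputable def metricInChart (g : RiemMetric m M) (p : M)
    (u v w : EuclideanSpace ℝ (Fin m)) : ℝ :=
  g.inner ((extChartAt (𝓡 m) p).symm u)
    (mfderiv 𝓘(ℝ, EuclideanSpace ℝ (Fin m)) (𝓡 m) (extChartAt (𝓡 m) p).symm u v)
    (mfderiv 𝓘(ℝ, EuclideanSpace ℝ (Fin m)) (𝓡 m) (extChartAt (𝓡 m) p).symm u w)

/-- `γ` is a smooth geodesic on the open set `s` of parameters. In a chart the geodesic equation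
of the Levi-Civita connection is the Euler-Lagrange equation of the energy,
`d/dt (g_{ij}(γ) γ'^i w^j) = (1/2) (∂_w g_{ij})(γ) γ'^i γ'^j` for all `w`. -/
def IsGeodesicOn (g : RiemMetric m M) (γ : ℝ → M) (s : Set ℝ) : Prop :=
  IsOpen s ∧ ContMDiffOn 𝓘(ℝ, ℝ) (𝓡 m) ∞ γ s ∧
    ∀ t ∈ s, ∀ w : EuclideanSpace ℝ (Fin m),
      let c : ℝ → EuclideanSpace ℝ (Fin m) := fun τ => extChartAt (𝓡 m) (γ t) (γ τ)
      deriv (fun τ => metricInChart g (γ t) (c τ) (deriv c τ) w) t =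
        (1 / 2) * fderiv ℝ (fun u => metricInChart g (γ t) u (deriv c t) (deriv c t)) (c t) w

/-- `γ` is a geodesic on an open interval containing `[0,1]` with initial vector `v` at `p`. -/
def IsUnitGeodesic (g : RiemMetric m M) (p : M) (v : TangentSpace (𝓡 m) p) (γ : ℝ → M) : Prop :=
  (∃ a b : ℝ, a < 0 ∧ 1 < b ∧ IsGeodesicOn g γ (Set.Ioo a b)) ∧
    (⟨γ 0, mfderiv 𝓘(ℝ, ℝ) (𝓡 m) γ 0 (1 : ℝ)⟩ : TangentBundle (𝓡 m) M) = ⟨p, v⟩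

open Classical in
/-- The exponential map `exp_p(v)`, with value `p` where it is not defined. -/
noncomputable def riemExp (g : RiemMetric m M) (p : M) (v : TangentSpace (𝓡 m) p) : M :=
  if h : ∃ γ, IsUnitGeodesic g p v γ then h.choose 1 else p

end Geodesics

section Tube

variable {n : ℕ} {X Y : Type*}
  [TopologicalSpace X] [ChartedSpace (EuclideanSpace ℝ (Fin n)) X] [IsManifold (𝓡 n) ∞ X]
  [TopologicalSpace Y] [ChartedSpace (EuclideanSpace ℝ (Fin (n + 1))) Y]
  [IsManifold (𝓡 (n + 1)) ∞ Y]

/-- A smooth unit normal vector field along `ι`. -/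
structure IsUnitNormal (gY : RiemMetric (n + 1) Y) (ι : X → Y)
    (ν : ∀ x, TangentSpace (𝓡 (n + 1)) (ι x)) : Prop where
  smooth : ContMDiff (𝓡 n) (𝓡 (n + 1)).tangent ∞
    (fun x => (⟨ι x, ν x⟩ : TangentBundle (𝓡 (n + 1)) Y))
  unit : ∀ x, gY.inner (ι x) (ν x) (ν x) = 1
  normal : ∀ x (v : TangentSpace (𝓡 n) x),
    gY.inner (ι x) (ν x) (mfderiv (𝓡 n) (𝓡 (n + 1)) ι x v) = 0

/-- A smooth Riemannian embedding. -/
structure IsRiemannianEmbedding (gX : RiemMetric n X) (gY : RiemMetric (n + 1) Y)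
    (ι : X → Y) : Prop where
  embedding : Manifold.IsSmoothEmbedding (𝓡 n) (𝓡 (n + 1)) ∞ ι
  isometric : ∀ x (v w : TangentSpace (𝓡 n) x),
    gY.inner (ι x) (mfderiv (𝓡 n) (𝓡 (n + 1)) ι x v) (mfderiv (𝓡 n) (𝓡 (n + 1)) ι x w) =
      gX.inner x v w

/-- The normal exponential map `(x, s) ↦ exp_{ι x}(s ν_x)`. -/
noncomputable def tubeMap (gY : RiemMetric (n + 1) Y) (ι : X → Y)
    (ν : ∀ x, TangentSpace (𝓡 (n + 1)) (ι x)) (q : X × ℝ) : Y :=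
  riemExp gY (ι q.1) (q.2 • ν q.1)

/-- On `X × (-ε₀, ε₀)` the normal exponential map is defined and is a diffeomorphism onto an open
subset of `Y`. -/
def IsTubularRadius (gY : RiemMetric (n + 1) Y) (ι : X → Y)
    (ν : ∀ x, TangentSpace (𝓡 (n + 1)) (ι x)) (ε₀ : ℝ) : Prop :=
  0 < ε₀ ∧ (∀ x, ∀ s ∈ Set.Ioo (-ε₀) ε₀, ∃ γ, IsUnitGeodesic gY (ι x) (s • ν x) γ) ∧
    ∃ Φ : PartialDiffeomorph ((𝓡 n).prod 𝓘(ℝ, ℝ)) (𝓡 (n + 1)) (X × ℝ) Y ∞,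
      Φ.source = Set.univ ×ˢ Set.Ioo (-ε₀) ε₀ ∧ Set.EqOn (tubeMap gY ι ν) Φ.toFun Φ.source

/-- The standard frame `(e₁, …, eₙ, ∂_s)` of the tangent space of `X × ℝ` at `q`. -/
noncomputable def tubeFrame (q : X × ℝ) :
    Fin n ⊕ Unit → TangentSpace ((𝓡 n).prod 𝓘(ℝ, ℝ)) q
  | Sum.inl i => ((EuclideanSpace.single i (1 : ℝ), (0 : ℝ)) : EuclideanSpace ℝ (Fin n) × ℝ)
  | Sum.inr _ => ((0, 1) : EuclideanSpace ℝ (Fin n) × ℝ)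

/-- The function `Λ` on `X × ℝ`: the ratio of the volume form of the product metric to the
pull-back of the volume form of `Y` along the normal exponential map, both evaluated on one and
the same frame by the square root of the Gram determinant. -/
noncomputable def volumeRatio (gX : RiemMetric n X) (gY : RiemMetric (n + 1) Y) (ι : X → Y)
    (ν : ∀ x, TangentSpace (𝓡 (n + 1)) (ι x)) (q : X × ℝ) : ℝ :=
  let dι := mfderiv ((𝓡 n).prod 𝓘(ℝ, ℝ)) (𝓡 (n + 1)) (tubeMap gY ι ν) q
  √(Matrix.det (Matrix.of fun i j : Fin n =>
        gX.inner q.1 (EuclideanSpace.single i (1 : ℝ)) (EuclideanSpace.single j (1 : ℝ)))) /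
    √(Matrix.det (Matrix.of fun i j : Fin n ⊕ Unit =>
        gY.inner (tubeMap gY ι ν q) (dι (tubeFrame q i)) (dι (tubeFrame q j))))

end Tube

/-! ### The immersion module -/

/-- The vector space `C₀(X × (-ε, ε), Cl₁)`. -/
abbrev TubeSections (X : Type*) [TopologicalSpace X] (ε : ℝ) : Type _ :=
  C₀(X × Set.Ioo (-ε) ε, Cl1)

/-- The bimodule structure from `C(X)` to `C₀(Y) ⊗ Cl₁` on `C₀(X × (-ε, ε), Cl₁)` given by
`(g ψ h)(x, s) = g(x) ψ(x, s) h(j(x, s))` and `⟨ψ, φ⟩(j(x, s)) = w(x, s) ψ(x, s)^* φ(x, s)`,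
with `⟨ψ, φ⟩ = 0` outside the range of `j` on `X × (-ε, ε)`, and graded by `Cl₁`. -/
structure IsTubeModule {X Y : Type*} [TopologicalSpace X] [CompactSpace X] [TopologicalSpace Y]
    (j : X × ℝ → Y) (w : X × ℝ → ℝ) (ε : ℝ)
    (M : GradedBimodule (CStarGrading.trivial C(X, ℂ)) (CStarGrading.c0Cl1 Y)
      (TubeSections X ε)) : Prop where
  left : ∀ (g : C(X, ℂ)) (ψ : TubeSections X ε) (p : X × Set.Ioo (-ε) ε),
    M.left g ψ p = g p.1 • ψ p
  act : ∀ (ψ : TubeSections X ε) (h : C₀(Y, Cl1)) (p : X × Set.Ioo (-ε) ε),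
    M.act ψ h p = ψ p * h (j (p.1, p.2))
  grade : ∀ (ψ : TubeSections X ε) (p : X × Set.Ioo (-ε) ε), M.grade ψ p = Cl1.grade (ψ p)
  inner : ∀ (ψ φ : TubeSections X ε) (p : X × Set.Ioo (-ε) ε),
    M.inner ψ φ (j (p.1, p.2)) = w (p.1, p.2) • (star (ψ p) * φ p)
  inner_off : ∀ (ψ φ : TubeSections X ε) (y : Y),
    (∀ p : X × Set.Ioo (-ε) ε, y ≠ j (p.1, p.2)) → M.inner ψ φ y = 0

/-- The function `f(s) = -(π / 2ε) tan(π s / 2ε)`. -/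
noncomputable def tanProfile (ε s : ℝ) : ℝ :=
  -(Real.pi / (2 * ε)) * Real.tan (Real.pi * s / (2 * ε))

/-- The operator `(S ψ)(x, s) = f(s) σ ψ(x, s)` with domain `{ψ | S ψ ∈ C₀(X × (-ε, ε), Cl₁)}`. -/
noncomputable def immersionOperator (X : Type*) [TopologicalSpace X] (ε : ℝ) :
    TubeSections X ε →ₗ.[ℂ] TubeSections X ε where
  domain :=
    { carrier := {ψ | ∃ φ : TubeSections X ε, ∀ p, φ p = tanProfile ε p.2 • (Cl1.σ * ψ p)}
      add_mem' := by
        rintro ψ ψ' ⟨φ, h⟩ ⟨φ', h'⟩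
        exact ⟨φ + φ', fun p => by
          rw [ZeroAtInftyContinuousMap.add_apply, ZeroAtInftyContinuousMap.add_apply, h, h',
            mul_add, smul_add]⟩
      zero_mem' := ⟨0, fun p => by simp⟩
      smul_mem' := by
        rintro c ψ ⟨φ, h⟩
        exact ⟨c • φ, fun p => by
          rw [ZeroAtInftyContinuousMap.smul_apply, ZeroAtInftyContinuousMap.smul_apply, h,
            mul_smul_comm, smul_comm]⟩ }
  toFun :=
    { toFun := fun ψ => ψ.2.choose
      map_add' := fun ψ ψ' => by
        refine DFunLike.ext _ _ fun p => ?_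
        rw [ZeroAtInftyContinuousMap.add_apply, (ψ + ψ').2.choose_spec p, ψ.2.choose_spec p,
          ψ'.2.choose_spec p, ← smul_add, ← mul_add]
        rfl
      map_smul' := fun c ψ => by
        refine DFunLike.ext _ _ fun p => ?_
        rw [RingHom.id_apply, ZeroAtInftyContinuousMap.smul_apply, (c • ψ).2.choose_spec p,
          ψ.2.choose_spec p, smul_comm c, ← mul_smul_comm c]
        rfl }

theorem immersionOperator_apply {X : Type*} [TopologicalSpace X] {ε : ℝ}
    (ψ : (immersionOperator X ε).domain) (p : X × Set.Ioo (-ε) ε) :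
    immersionOperator X ε ψ p = tanProfile ε p.2 • (Cl1.σ * (ψ : TubeSections X ε) p) :=
  ψ.2.choose_spec p

/-- The standard bounded cycles for the shriek class of a codimension one embedding with
trivialized normal bundle: the Thom class of the normal bundle `X × ℝ`, restricted to radius `r`
and pushed forward along the open embedding `j` of `X × (-r, r)` in `Y`. It is given by the
unweighted module `C₀(X × (-r, r), Cl₁)` and multiplication by `-χ(s) σ`, where `χ` is any
continuous function on `[-r, r]` with `χ(±r) = ±1`. -/
structure IsShriekCycle {X Y : Type*} [TopologicalSpace X] [CompactSpace X] [TopologicalSpace Y]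
    (j : X × ℝ → Y) (r : ℝ) (χ : ℝ → ℝ)
    (M : GradedBimodule (CStarGrading.trivial C(X, ℂ)) (CStarGrading.c0Cl1 Y)
      (TubeSections X r)) (F : TubeSections X r →ₗ[ℂ] TubeSections X r) : Prop where
  module : IsTubeModule j (fun _ => 1) r M
  operator : ∀ (ψ : TubeSections X r) (p : X × Set.Ioo (-r) r),
    F ψ p = (-χ p.2) • (Cl1.σ * ψ p)
  cycle : M.IsBoundedKKCycle F

/-! ### Functions vanishing at infinity with values in the Clifford algebra. -/

section ZeroAtInfinity

open Topology BoundedContinuousFunction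

variable {P Z X : Type*} [TopologicalSpace P] [TopologicalSpace Z] [TopologicalSpace X]

/-! Without its grading `Cl1` is the commutative algebra `ℂ × ℂ`, so every operator that matters is
pointwise multiplication on some `C₀(P, Cl1)`, and the analytic claims become claims about
functions. A weight bounded above and away from zero does no harm: multiplication by its square root
is an isometry from the weighted module norm to the sup norm (`weightedModule_norm`). Multiplication
by an element of `C₀` is a compact operator (`weightedModule_isCompactOp_mulOp`), because cutting
off by a compactly supported function already gives a rank one operator.

Let `f` be real and continuous with `|f| → ∞` at infinity, and let `S` be multiplication by `f σ` on
its maximal domain (`IsMaximalMul`). Testing against compactly supported functions shows that `S` is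
self-adjoint. The resolvents are multiplication by `(f σ - c) / (1 + f ^ 2)`, which lies in `C₀`.
Functions on `X` commute with `S` exactly, so all commutators vanish. The tangent profile is of this
kind because it blows up at `±ε`.

The bounded transform is multiplication by `-χ₀(s) σ`, where `χ₀` extends continuously to `[-ε, ε]`
with `χ₀(±ε) = ±1`. It therefore has the shape of the Thom operator, and only radius, weight and
profile remain to be deformed. All three are interpolated linearly in time, with the profiles
rescaled to the current radius (`sameKKClass_tube`). The homotopy lives on functions on the track
`{(t, x, s) : |s| < radius t}`, an open subset of `[0,1] × Y`. Since `C([0,1], C₀(Y, Cl1))` is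
`C₀([0,1] × Y, Cl1)`, the module construction used for a single tube applies again; for this reason
`weightedModule` allows a coefficient algebra `B` isomorphic to `C₀(Z, Cl1)`.

Geometry enters twice: the normal exponential map is an open embedding on the tube, and `Λ` is
continuous and positive there (`continuousAt_volumeRatio`, `volumeRatio_pos`), hence bounded above
and below on smaller tubes by compactness of `X`. -/

theorem ZeroAtInftyContinuousMap.exists_isCompact_norm_lt (f : C₀(P, Cl1)) {δ : ℝ} (hδ : 0 < δ) :
    ∃ K : Set P, IsCompact K ∧ ∀ q, q ∉ K → ‖f q‖ < δ := by
  have h := f.zero_at_infty' (Metric.ball_mem_nhds 0 hδ)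
  obtain ⟨K, hK, hKs⟩ := Filter.mem_cocompact.1 h
  exact ⟨K, hK, fun q hq => by simpa using hKs hq⟩

/-- Construct an element of `C₀(P, Cl₁)` from smallness off compact sets. -/
def c0Mk (f : P → Cl1) (hf : Continuous f)
    (h : ∀ δ > 0, ∃ K : Set P, IsCompact K ∧ ∀ q, q ∉ K → ‖f q‖ < δ) : C₀(P, Cl1) where
  toFun := f
  continuous_toFun := hf
  zero_at_infty' := by
    refine Metric.tendsto_nhds.2 fun δ hδ => ?_
    obtain ⟨K, hK, hKf⟩ := h δ hδ
    exact Filter.mem_cocompact.2 ⟨K, hK, fun q hq => by simpa using hKf q hq⟩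

@[simp] theorem c0Mk_apply (f : P → Cl1) (hf h) (q : P) : c0Mk f hf h q = f q := rfl

theorem ZeroAtInftyContinuousMap.norm_apply_le (f : C₀(P, Cl1)) (q : P) : ‖f q‖ ≤ ‖f‖ := by
  rw [← f.norm_toBCF_eq_norm]
  exact f.toBCF.norm_coe_le_norm q

theorem ZeroAtInftyContinuousMap.norm_le_of_forall (f : C₀(P, Cl1)) {c : ℝ} (hc : 0 ≤ c)
    (h : ∀ q, ‖f q‖ ≤ c) : ‖f‖ ≤ c := by
  rw [← f.norm_toBCF_eq_norm]
  exact (BoundedContinuousFunction.norm_le hc).2 h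

/-- Multiplication operators on `C₀(P, Cl₁)`. -/
noncomputable def mulOp : (P →ᵇ Cl1) →ₐ[ℂ] Module.End ℂ C₀(P, Cl1) where
  toFun m :=
    { toFun := fun ψ => c0Mk (fun q => m q * ψ q) (m.continuous.mul ψ.continuous) fun δ hδ => by
        obtain ⟨K, hK, h⟩ := ψ.exists_isCompact_norm_lt (δ := δ / (‖m‖ + 1)) (by positivity)
        refine ⟨K, hK, fun q hq => ?_⟩
        have h1 := h q hq
        rw [lt_div_iff₀ (by positivity)] at h1
        calc ‖m q * ψ q‖ ≤ ‖m q‖ * ‖ψ q‖ := norm_mul_le _ _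
          _ ≤ (‖m‖ + 1) * ‖ψ q‖ := by
            gcongr
            linarith [m.norm_coe_le_norm q]
          _ < δ := by linarith
      map_add' := fun ψ φ => by ext q <;> simp [mul_add]
      map_smul' := fun c ψ => by
        refine ZeroAtInftyContinuousMap.ext fun q => ?_
        simp }
  map_one' := by ext ψ q <;> simp
  map_mul' m m' := by ext ψ q <;> simp [mul_assoc]
  map_zero' := by ext ψ q <;> simp
  map_add' m m' := by ext ψ q <;> simp [add_mul]
  commutes' c := by
    refine LinearMap.ext fun ψ => ZeroAtInftyContinuousMap.ext fun q => ?_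
    simp [Algebra.algebraMap_eq_smul_one]

@[simp] theorem mulOp_apply (m : P →ᵇ Cl1) (ψ : C₀(P, Cl1)) (q : P) :
    mulOp m ψ q = m q * ψ q := rfl

theorem norm_mulOp_le (m : P →ᵇ Cl1) (ψ : C₀(P, Cl1)) : ‖mulOp m ψ‖ ≤ ‖m‖ * ‖ψ‖ := by
  refine ZeroAtInftyContinuousMap.norm_le_of_forall _ (by positivity) fun q => ?_
  exact (norm_mul_le _ _).trans
    (mul_le_mul (m.norm_coe_le_norm q) (ψ.norm_apply_le q) (norm_nonneg _) (norm_nonneg _))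

/-- Extension by zero along an open embedding. -/
noncomputable def c0Extend [T2Space Z] {J : P → Z} (hJ : IsOpenEmbedding J) (f : C₀(P, Cl1)) :
    C₀(Z, Cl1) :=
  have key : ∀ δ > 0, ∃ K : Set Z, IsCompact K ∧ K ⊆ Set.range J ∧
      ∀ z, z ∉ K → ‖Function.extend J f 0 z‖ < δ := fun δ hδ => by
    obtain ⟨K, hK, h⟩ := f.exists_isCompact_norm_lt hδ
    refine ⟨J '' K, hK.image hJ.continuous, Set.image_subset_range _ _, fun z hz => ?_⟩
    by_cases hz' : ∃ q, J q = z
    · obtain ⟨q, rfl⟩ := hz'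
      rw [hJ.injective.extend_apply]
      exact h q fun hq => hz ⟨q, hq, rfl⟩
    · rw [Function.extend_apply' _ _ _ hz']
      simpa using hδ
  c0Mk (Function.extend J f 0)
    (by
      refine continuous_iff_continuousAt.2 fun z => ?_
      by_cases hz : ∃ q, J q = z
      · obtain ⟨q, rfl⟩ := hz
        rw [← hJ.continuousAt_iff]
        rw [show Function.extend J f 0 ∘ J = f from funext fun q => hJ.injective.extend_apply _ _ _]
        exact f.continuous.continuousAt
      -- Off the range the value is zero. The compact set outside which the extension is small is
      -- closed, `Z` being Hausdorff, and lies in the range, so its complement is a neighbourhood of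
      -- `z`.
      · refine Metric.tendsto_nhds.2 fun δ hδ => ?_
        obtain ⟨K, hK, hKr, h⟩ := key δ hδ
        have hzK : Kᶜ ∈ 𝓝 z := hK.isClosed.isOpen_compl.mem_nhds fun h => hz (hKr h)
        filter_upwards [hzK] with y hy
        rw [Function.extend_apply' _ _ _ hz]
        simpa using h y hy)
    fun δ hδ => by
      obtain ⟨K, hK, -, h⟩ := key δ hδ
      exact ⟨K, hK, h⟩

@[simp] theorem c0Extend_apply [T2Space Z] {J : P → Z} (hJ : IsOpenEmbedding J) (f : C₀(P, Cl1))
    (q : P) : c0Extend hJ f (J q) = f q :=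
  hJ.injective.extend_apply _ _ _

theorem c0Extend_apply_of_forall_ne [T2Space Z] {J : P → Z} (hJ : IsOpenEmbedding J)
    (f : C₀(P, Cl1)) {z : Z} (hz : ∀ q, z ≠ J q) : c0Extend hJ f z = 0 :=
  Function.extend_apply' _ _ _ fun ⟨q, hq⟩ => hz q hq.symm

/-- Two elements of `C₀(Z, Cl₁)` supported in the range of `J` agree if they agree there. -/
theorem eq_c0Extend_iff [T2Space Z] {J : P → Z} (hJ : IsOpenEmbedding J) (f : C₀(P, Cl1))
    (g : C₀(Z, Cl1)) :
    g = c0Extend hJ f ↔ (∀ q, g (J q) = f q) ∧ ∀ z, (∀ q, z ≠ J q) → g z = 0 := by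
  refine ⟨?_, fun ⟨h1, h2⟩ => ZeroAtInftyContinuousMap.ext fun z => ?_⟩
  · rintro rfl
    exact ⟨fun q => c0Extend_apply hJ f q, fun z hz => c0Extend_apply_of_forall_ne hJ f hz⟩
  · by_cases hz : ∃ q, J q = z
    · obtain ⟨q, rfl⟩ := hz
      rw [h1, c0Extend_apply]
    · have hz' : ∀ q, z ≠ J q := fun q hq => hz ⟨q, hq.symm⟩
      rw [h2 z hz', c0Extend_apply_of_forall_ne hJ f hz']

section Extend

variable [T2Space Z] {J : P → Z} (hJ : IsOpenEmbedding J)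

theorem c0Extend_add (f g : C₀(P, Cl1)) :
    c0Extend hJ (f + g) = c0Extend hJ f + c0Extend hJ g :=
  Eq.symm <| (eq_c0Extend_iff hJ _ _).2 ⟨fun q => by simp, fun z hz => by
    simp [c0Extend_apply_of_forall_ne hJ _ hz]⟩

theorem c0Extend_smul (c : ℂ) (f : C₀(P, Cl1)) :
    c0Extend hJ (c • f) = c • c0Extend hJ f :=
  Eq.symm <| (eq_c0Extend_iff hJ _ _).2 ⟨fun q => by simp, fun z hz => by
    simp [c0Extend_apply_of_forall_ne hJ _ hz]⟩

theorem c0Extend_mul (f g : C₀(P, Cl1)) :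
    c0Extend hJ (f * g) = c0Extend hJ f * c0Extend hJ g :=
  Eq.symm <| (eq_c0Extend_iff hJ _ _).2 ⟨fun q => by simp, fun z hz => by
    simp [c0Extend_apply_of_forall_ne hJ _ hz]⟩

theorem c0Extend_star (f : C₀(P, Cl1)) : c0Extend hJ (star f) = star (c0Extend hJ f) :=
  Eq.symm <| (eq_c0Extend_iff hJ _ _).2 ⟨fun q => by simp, fun z hz => by
    simp [c0Extend_apply_of_forall_ne hJ _ hz]⟩

theorem c0Extend_grade (f : C₀(P, Cl1)) :
    c0Extend hJ ((CStarGrading.c0Cl1 P).hom f) = (CStarGrading.c0Cl1 Z).hom (c0Extend hJ f) :=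
  Eq.symm <| (eq_c0Extend_iff hJ _ _).2 ⟨fun q => by
    change Cl1.grade (c0Extend hJ f (J q)) = Cl1.grade (f q)
    rw [c0Extend_apply], fun z hz => by
    change Cl1.grade (c0Extend hJ f z) = 0
    rw [c0Extend_apply_of_forall_ne hJ _ hz, map_zero]⟩

theorem norm_c0Extend (f : C₀(P, Cl1)) : ‖c0Extend hJ f‖ = ‖f‖ := by
  refine le_antisymm ?_ ?_
  · refine ZeroAtInftyContinuousMap.norm_le_of_forall _ (norm_nonneg _) fun z => ?_
    by_cases hz : ∃ q, J q = z
    · obtain ⟨q, rfl⟩ := hz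
      rw [c0Extend_apply]
      exact f.norm_apply_le q
    · rw [c0Extend_apply_of_forall_ne hJ f fun q hq => hz ⟨q, hq.symm⟩, norm_zero]
      exact norm_nonneg _
  · refine ZeroAtInftyContinuousMap.norm_le_of_forall _ (norm_nonneg _) fun q => ?_
    rw [← c0Extend_apply hJ f q]
    exact (c0Extend hJ f).norm_apply_le _

end Extend

/-- The restriction of an element of `C₀(Z, Cl₁)` along a continuous map, as a multiplier. -/
noncomputable def c0Restrict {J : P → Z} (hJ : Continuous J) (h : C₀(Z, Cl1)) : P →ᵇ Cl1 :=
  h.toBCF.compContinuous ⟨J, hJ⟩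

@[simp] theorem c0Restrict_apply {J : P → Z} (hJ : Continuous J) (h : C₀(Z, Cl1)) (q : P) :
    c0Restrict hJ h q = h (J q) := rfl

/-- A continuous function vanishing off a compact set, as an element of `C₀(P, Cl₁)`. -/
def c0OfSupport (f : P → Cl1) (hf : Continuous f) {L : Set P} (hL : IsCompact L)
    (h : ∀ q, q ∉ L → f q = 0) : C₀(P, Cl1) :=
  c0Mk f hf fun δ hδ => ⟨L, hL, fun q hq => by rw [h q hq, norm_zero]; exact hδ⟩

@[simp] theorem c0OfSupport_apply (f : P → Cl1) (hf) {L : Set P} (hL : IsCompact L) (h) (q : P) :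
    c0OfSupport f hf hL h q = f q := rfl

/-- Compactly supported cutoff functions. -/
theorem exists_c0_cutoff [T2Space P] [LocallyCompactSpace P] {K : Set P} (hK : IsCompact K) :
    ∃ u : C₀(P, Cl1), (∃ L : Set P, IsCompact L ∧ ∀ q, q ∉ L → u q = 0) ∧
      (∀ q ∈ K, u q = 1) ∧ ∀ q, ‖1 - u q‖ ≤ 1 := by
  obtain ⟨u, h1, -, hu, h01⟩ := exists_continuous_one_zero_of_isCompact hK isClosed_empty
    (Set.disjoint_empty K)
  have hu : IsCompact (tsupport u) := hu
  have hs : ∀ q, q ∉ tsupport u → u q • (1 : Cl1) = 0 := fun q hq => by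
    rw [image_eq_zero_of_notMem_tsupport hq, zero_smul]
  refine ⟨c0OfSupport (fun q => u q • (1 : Cl1)) (by fun_prop) hu hs,
    ⟨tsupport u, hu, fun q hq => hs q hq⟩, fun q hq => ?_, fun q => ?_⟩
  · simp [h1 hq]
  · rw [c0OfSupport_apply, show (1 : Cl1) - u q • (1 : Cl1) = (1 - u q) • (1 : Cl1) by
      rw [sub_smul, one_smul], norm_smul, norm_one, mul_one, Real.norm_eq_abs, abs_le]
    exact ⟨by linarith [(h01 q).2], by linarith [(h01 q).1]⟩

/-- The compact set is chosen before the cutoff `u`, so any cutoff adapted to it will do: on `K` the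
error vanishes, off `K` it is dominated by `ψ` itself. -/
theorem ZeroAtInftyContinuousMap.exists_isCompact_norm_sub_mul_le (ψ : C₀(P, Cl1)) {δ : ℝ}
    (hδ : 0 < δ) : ∃ K : Set P, IsCompact K ∧ ∀ u : C₀(P, Cl1), (∀ q ∈ K, u q = 1) →
      (∀ q, ‖1 - u q‖ ≤ 1) → ‖ψ - u * ψ‖ ≤ δ := by
  obtain ⟨K, hK, h⟩ := ψ.exists_isCompact_norm_lt hδ
  refine ⟨K, hK, fun u h1 hu => ZeroAtInftyContinuousMap.norm_le_of_forall _ hδ.le fun q => ?_⟩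
  rw [ZeroAtInftyContinuousMap.sub_apply, ZeroAtInftyContinuousMap.mul_apply,
    show ψ q - u q * ψ q = (1 - u q) * ψ q by ring]
  by_cases hq : q ∈ K
  · rw [h1 q hq, sub_self, zero_mul, norm_zero]
    exact hδ.le
  · calc ‖(1 - u q) * ψ q‖ ≤ ‖1 - u q‖ * ‖ψ q‖ := norm_mul_le _ _
      _ ≤ 1 * ‖ψ q‖ := by gcongr; exact hu q
      _ ≤ δ := by linarith [h q hq]

end ZeroAtInfinity

/-! ### Weighted Hilbert modules and their compact operators. -/

section WeightedModule

open Topology BoundedContinuousFunction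

/-- A weight for `C₀(P, Cl₁)`: a positive function, bounded above and below, given through its
square root and the inverse of the latter. -/
structure C0Weight (P : Type*) [TopologicalSpace P] where
  root : P →ᵇ ℝ
  inv : P →ᵇ ℝ
  root_mul_inv : ∀ q, root q * inv q = 1

section Multipliers

variable {P X : Type*} [TopologicalSpace P] [TopologicalSpace X] [CompactSpace X]

/-- Functions on the compact space `X` act on `C₀(P, Cl₁)` through a map `P → X`. -/
noncomputable def pullMul (p : C(P, X)) : C(X, ℂ) →ₙₐ[ℂ] Module.End ℂ C₀(P, Cl1) where
  toFun g := mulOp ((BoundedContinuousFunction.mkOfCompact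
    (⟨fun x => algebraMap ℂ Cl1 (g x), by fun_prop⟩ : C(X, Cl1))).compContinuous p)
  map_smul' c g := by ext ψ q <;> simp [mul_assoc]
  map_zero' := by ext ψ q <;> simp
  map_add' g h := by ext ψ q <;> simp [add_mul]
  map_mul' g h := by ext ψ q <;> simp [mul_assoc]

theorem pullMul_apply (p : C(P, X)) (g : C(X, ℂ)) (ψ : C₀(P, Cl1)) (q : P) :
    pullMul p g ψ q = g (p q) • ψ q := by
  ext <;> simp [pullMul]

theorem exists_pullMul_eq_mulOp (p : C(P, X)) (g : C(X, ℂ)) : ∃ m, pullMul p g = mulOp m :=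
  ⟨_, rfl⟩

/-- A bounded real function as a multiplier. -/
noncomputable def realMult (V : P →ᵇ ℝ) : P →ᵇ Cl1 :=
  BoundedContinuousFunction.ofNormedAddCommGroup (fun q => V q • (1 : Cl1)) (by fun_prop) ‖V‖
    fun q => by
      rw [norm_smul, norm_one, mul_one]
      exact V.norm_coe_le_norm q

@[simp] theorem realMult_apply (V : P →ᵇ ℝ) (q : P) : realMult V q = V q • (1 : Cl1) := rfl

/-- This is commutativity of `Cl1` as an ungraded algebra. It lets the weight be moved past every
multiplication operator. -/
theorem mulOp_commute (m m' : P →ᵇ Cl1) (ψ : C₀(P, Cl1)) :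
    mulOp m (mulOp m' ψ) = mulOp m' (mulOp m ψ) := by
  ext q <;> simp [mul_left_comm]

theorem mulOp_inv_root (V : C0Weight P) (ψ : C₀(P, Cl1)) :
    mulOp (realMult V.inv) (mulOp (realMult V.root) ψ) = ψ := by
  refine ZeroAtInftyContinuousMap.ext fun q => ?_
  simp [smul_smul, V.root_mul_inv]

theorem mulOp_root_inv (V : C0Weight P) (ψ : C₀(P, Cl1)) :
    mulOp (realMult V.root) (mulOp (realMult V.inv) ψ) = ψ := by
  rw [mulOp_commute, mulOp_inv_root]

theorem c0_norm_star_mul_self (f : C₀(P, Cl1)) : ‖star f * f‖ = ‖f‖ * ‖f‖ :=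
  CStarRing.norm_star_mul_self

theorem c0_star_star_mul (f g : C₀(P, Cl1)) : star (star f * g) = star g * f := by
  ext q <;> simp [mul_comm]

theorem norm_starAlgEquiv_symm {B : Type*} [NonUnitalCStarAlgebra B] (e : B ≃⋆ₐ[ℂ] C₀(P, Cl1))
    (f : C₀(P, Cl1)) : ‖e.symm f‖ = ‖f‖ :=
  NonUnitalStarAlgHom.norm_map e.symm e.symm.injective f

end Multipliers

variable {P Z X B : Type*} [TopologicalSpace P] [T2Space P] [LocallyCompactSpace P]
  [SigmaCompactSpace P] [TopologicalSpace Z] [T2Space Z] [TopologicalSpace X] [CompactSpace X]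
  [NonUnitalCStarAlgebra B]

/-- Cutoffs along a compact exhaustion. This is where σ-compactness gives countable generation. -/
theorem exists_c0_approximateUnit :
    ∃ u : ℕ → C₀(P, Cl1), ∀ ψ : C₀(P, Cl1), ∀ δ > 0, ∃ N, ‖ψ - u N * ψ‖ ≤ δ := by
  let K : CompactExhaustion P := default
  choose u hu h1 hn using fun n => exists_c0_cutoff (K.isCompact n)
  refine ⟨u, fun ψ δ hδ => ?_⟩
  obtain ⟨L, hL, h⟩ := ψ.exists_isCompact_norm_sub_mul_le hδ
  obtain ⟨N, hN⟩ := K.exists_superset_of_isCompact hL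
  exact ⟨N, h _ (fun q hq => h1 N q (hN hq)) (hn N)⟩

/-- The Hilbert module `C₀(P, Cl₁)` over `B ≅ C₀(Z, Cl₁)` with a weighted inner product, induced
by an open embedding `J : P → Z`; the algebra `C(X)` acts through a map `P → X`. -/
noncomputable def weightedModule {β : CStarGrading B} (e : B ≃⋆ₐ[ℂ] C₀(Z, Cl1))
    (he : ∀ b, e (β.hom b) = (CStarGrading.c0Cl1 Z).hom (e b)) {J : P → Z}
    (hJ : IsOpenEmbedding J) (V : C0Weight P) (p : C(P, X)) :
    GradedBimodule (CStarGrading.trivial C(X, ℂ)) β C₀(P, Cl1) :=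
  have norm_eq : ∀ ψ : C₀(P, Cl1), √‖e.symm (c0Extend hJ (star (mulOp (realMult V.root) ψ) *
      mulOp (realMult V.root) ψ))‖ = ‖mulOp (realMult V.root) ψ‖ := fun ψ => by
    rw [norm_starAlgEquiv_symm, norm_c0Extend, c0_norm_star_mul_self,
      Real.sqrt_mul_self (norm_nonneg _)]
  { act := LinearMap.mk₂ ℂ (fun ψ b => mulOp (c0Restrict hJ.continuous (e b)) ψ)
      (fun ψ φ b => map_add _ _ _) (fun c ψ b => map_smul _ _ _)
      (fun ψ b c => by ext q <;> simp [add_mul]) (fun c ψ b => by ext q <;> simp)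
    act_mul := fun ψ b c => by ext q <;> simp [mul_left_comm, mul_assoc]
    inner := fun ψ φ => e.symm (c0Extend hJ
      (star (mulOp (realMult V.root) ψ) * mulOp (realMult V.root) φ))
    inner_add_right := fun x y z => by rw [map_add, mul_add, c0Extend_add, map_add]
    inner_smul_right := fun c x y => by
      rw [map_smul, mul_smul_comm, c0Extend_smul, map_smul]
    inner_act_right := fun x y b => by
      rw [StarAlgEquiv.symm_apply_eq, map_mul, StarAlgEquiv.apply_symm_apply, eq_comm,
        eq_c0Extend_iff]
      refine ⟨fun q => ?_, fun z hz => ?_⟩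
      · simp [mul_left_comm, mul_comm, mul_assoc]
      · simp [c0Extend_apply_of_forall_ne hJ _ hz]
    star_inner := fun x y => by
      rw [← map_star, ← c0Extend_star, c0_star_star_mul]
    inner_self_nonneg := fun x => ⟨e.symm (c0Extend hJ (mulOp (realMult V.root) x)), by
      rw [← map_star e.symm, ← map_mul e.symm, ← c0Extend_star, ← c0Extend_mul]⟩
    inner_self_eq_zero := fun x hx => by
      have h := norm_eq x
      rw [hx, norm_zero, Real.sqrt_zero, eq_comm, norm_eq_zero] at h
      rw [← mulOp_inv_root V x, h, map_zero]
    complete := fun u hu => by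
      simp only [norm_eq] at hu ⊢
      have hc : CauchySeq fun n => mulOp (realMult V.root) (u n) := by
        refine Metric.cauchySeq_iff.2 fun δ hδ => ?_
        obtain ⟨N, hN⟩ := hu δ hδ
        exact ⟨N, fun m hm k hk => by rw [dist_eq_norm, ← map_sub]; exact hN m hm k hk⟩
      obtain ⟨y, hy⟩ := cauchySeq_tendsto_of_complete hc
      -- The limit is taken in the sup norm after multiplication by the root, then divided by the
      -- root again.
      refine ⟨mulOp (realMult V.inv) y, fun δ hδ => ?_⟩
      obtain ⟨N, hN⟩ := Metric.tendsto_atTop.1 hy δ hδ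
      refine ⟨N, fun m hm => ?_⟩
      rw [map_sub, mulOp_root_inv, ← dist_eq_norm]
      exact hN m hm
    countably_generated := by
      obtain ⟨u, hu⟩ := exists_c0_approximateUnit (P := P)
      refine ⟨u, fun x δ hδ => ?_⟩
      simp only [norm_eq]
      obtain ⟨N, hN⟩ := hu (mulOp (realMult V.root) x) (δ / 2) (by positivity)
      -- A single generator suffices: `u N` acted on by the extension of `x` is `u N * x`. The sum
      -- runs to `N + 1` so that the index `N` is included.
      refine ⟨N + 1, Pi.single N (e.symm (c0Extend hJ x)), ?_⟩
      rw [Finset.sum_eq_single N]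
      · have : mulOp (realMult V.root) x - u N * mulOp (realMult V.root) x =
            mulOp (realMult V.root) (x - mulOp (c0Restrict hJ.continuous
              (e (e.symm (c0Extend hJ x)))) (u N)) := by
          rw [StarAlgEquiv.apply_symm_apply]
          refine ZeroAtInftyContinuousMap.ext fun q => ?_
          simp [mul_comm]
        rw [this] at hN
        simp only [Pi.single_eq_same, LinearMap.mk₂_apply]
        linarith
      · intro i _ hi
        rw [Pi.single_eq_of_ne hi, map_zero]
      · simp
    grade :=
      { toFun := (CStarGrading.c0Cl1 P).hom
        map_add' := map_add _
        map_smul' := map_smul _ }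
    grade_grade := (CStarGrading.c0Cl1 P).hom_hom
    grade_act := fun x b => by
      refine ZeroAtInftyContinuousMap.ext fun q => ?_
      simp only [LinearMap.mk₂_apply, he]
      exact map_mul Cl1.grade _ _
    inner_grade := fun x y => by
      rw [StarAlgEquiv.symm_apply_eq, he, StarAlgEquiv.apply_symm_apply, ← c0Extend_grade]
      congr 1
    left := pullMul p
    inner_left := fun a x y => by
      congr 2
      refine ZeroAtInftyContinuousMap.ext fun q => ?_
      simp only [ZeroAtInftyContinuousMap.mul_apply, ZeroAtInftyContinuousMap.star_apply,
        mulOp_apply, pullMul_apply]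
      simp [mul_comm]
    grade_left := fun a x => by
      refine ZeroAtInftyContinuousMap.ext fun q => ?_
      change Cl1.grade (pullMul p a x q) = pullMul p a _ q
      rw [pullMul_apply, pullMul_apply]
      exact map_smul Cl1.grade _ _ }

variable {β : CStarGrading B} (e : B ≃⋆ₐ[ℂ] C₀(Z, Cl1))
    (he : ∀ b, e (β.hom b) = (CStarGrading.c0Cl1 Z).hom (e b)) {J : P → Z}
    (hJ : IsOpenEmbedding J) (V : C0Weight P) (p : C(P, X))

theorem weightedModule_inner (ψ φ : C₀(P, Cl1)) : (weightedModule e he hJ V p).inner ψ φ =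
    e.symm (c0Extend hJ (star (mulOp (realMult V.root) ψ) * mulOp (realMult V.root) φ)) := rfl

theorem weightedModule_act (ψ : C₀(P, Cl1)) (b : B) :
    (weightedModule e he hJ V p).act ψ b = mulOp (c0Restrict hJ.continuous (e b)) ψ := rfl

theorem weightedModule_left : (weightedModule e he hJ V p).left = pullMul p := rfl

theorem weightedModule_grade_apply (ψ : C₀(P, Cl1)) (q : P) :
    (weightedModule e he hJ V p).grade ψ q = Cl1.grade (ψ q) := rfl

theorem weightedModule_norm (ψ : C₀(P, Cl1)) :
    (weightedModule e he hJ V p).norm ψ = ‖mulOp (realMult V.root) ψ‖ := by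
  rw [GradedBimodule.norm, weightedModule_inner, norm_starAlgEquiv_symm, norm_c0Extend,
    c0_norm_star_mul_self, Real.sqrt_mul_self (norm_nonneg _)]

theorem weightedModule_norm_mulOp_le (m : P →ᵇ Cl1) (ψ : C₀(P, Cl1)) :
    (weightedModule e he hJ V p).norm (mulOp m ψ) ≤ ‖m‖ * (weightedModule e he hJ V p).norm ψ := by
  rw [weightedModule_norm, weightedModule_norm, mulOp_commute]
  exact norm_mulOp_le _ _

theorem weightedModule_isAdjointPair_mulOp (m : P →ᵇ Cl1) :
    (weightedModule e he hJ V p).IsAdjointPair (mulOp m) (mulOp (star m)) := fun ψ φ => by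
  rw [weightedModule_inner, weightedModule_inner]
  congr 2
  refine ZeroAtInftyContinuousMap.ext fun q => ?_
  simp [mul_comm, mul_assoc]

/-- Rank one operators are themselves multiplication operators: the extension by zero is evaluated
only along `J`, where it returns the original function. -/
theorem weightedModule_act_inner (x y z : C₀(P, Cl1)) :
    (weightedModule e he hJ V p).act x ((weightedModule e he hJ V p).inner y z) =
      mulOp (x * star (mulOp (realMult V.root) y)).toBCF (mulOp (realMult V.root) z) := by
  rw [weightedModule_inner, weightedModule_act, StarAlgEquiv.apply_symm_apply]
  refine ZeroAtInftyContinuousMap.ext fun q => ?_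
  simp only [mulOp_apply, c0Restrict_apply, c0Extend_apply, ZeroAtInftyContinuousMap.mul_apply,
    ZeroAtInftyContinuousMap.star_apply]
  change _ = x q * star (realMult V.root q * y q) * (realMult V.root q * z q)
  ring

/-- Multiplication by a function vanishing at infinity is a compact operator. -/
theorem weightedModule_isCompactOp_mulOp (f : C₀(P, Cl1)) :
    (weightedModule e he hJ V p).IsCompactOp (mulOp f.toBCF) := fun δ hδ => by
  obtain ⟨K, hK, h⟩ := f.exists_isCompact_norm_sub_mul_le hδ
  obtain ⟨u, -, h1, hu⟩ := exists_c0_cutoff hK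
  -- Dividing both vectors by the root cancels the weight, so this rank one operator is
  -- multiplication by `u * f`, which is within `δ` of `f`.
  refine ⟨1, fun _ => mulOp (realMult V.inv) f, fun _ => mulOp (realMult V.inv) (star u),
    fun z => ?_⟩
  have key : mulOp f.toBCF z - ∑ i ∈ Finset.range 1, (weightedModule e he hJ V p).act
      (mulOp (realMult V.inv) f) ((weightedModule e he hJ V p).inner
        (mulOp (realMult V.inv) (star u)) z) = mulOp (f - u * f).toBCF z := by
    rw [Finset.sum_range_one, weightedModule_act_inner, mulOp_root_inv, star_star]
    refine ZeroAtInftyContinuousMap.ext fun q => ?_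
    change f q * z q - V.inv q • (1 : Cl1) * f q * u q * (V.root q • (1 : Cl1) * z q) =
      (f q - u q * f q) * z q
    have hV : V.inv q • (1 : Cl1) * (V.root q • (1 : Cl1)) = 1 := by
      rw [smul_mul_smul_comm, mul_comm, V.root_mul_inv, one_smul, one_mul]
    linear_combination (-(f q * u q * z q)) * hV
  rw [key]
  refine (weightedModule_norm_mulOp_le e he hJ V p _ z).trans ?_
  rw [ZeroAtInftyContinuousMap.norm_toBCF_eq_norm]
  exact mul_le_mul_of_nonneg_right (h u h1 hu) (Real.sqrt_nonneg _)

theorem weightedModule_isCompactOp_zero :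
    (weightedModule e he hJ V p).IsCompactOp 0 := by
  have h := weightedModule_isCompactOp_mulOp e he hJ V p 0
  rwa [show (0 : C₀(P, Cl1)).toBCF = 0 from rfl, map_zero] at h

theorem weightedModule_isCompactOp_left_mul (f : C₀(P, Cl1)) (a : C(X, ℂ)) :
    (weightedModule e he hJ V p).IsCompactOp
      ((weightedModule e he hJ V p).left a * mulOp f.toBCF) := by
  obtain ⟨m, hm⟩ := exists_pullMul_eq_mulOp p a
  rw [weightedModule_left, hm, ← map_mul]
  exact weightedModule_isCompactOp_mulOp e he hJ V p (mulOp m f)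

/-- Multiplication by `m σ` for a bounded real function `m` with `1 - m ^ 2` vanishing at infinity
gives a bounded cycle. -/
theorem weightedModule_isBoundedKKCycle (m : P →ᵇ ℝ) (f : C₀(P, Cl1))
    (hf : ∀ q, f q = (m q ^ 2 - 1) • (1 : Cl1)) (F : C₀(P, Cl1) →ₗ[ℂ] C₀(P, Cl1))
    (hF : ∀ ψ q, F ψ q = m q • (Cl1.σ * ψ q)) :
    (weightedModule e he hJ V p).IsBoundedKKCycle F where
  odd x := by
    refine ZeroAtInftyContinuousMap.ext fun q => ?_
    rw [ZeroAtInftyContinuousMap.neg_apply, weightedModule_grade_apply, hF, hF,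
      weightedModule_grade_apply]
    ext <;> simp [Cl1.σ, Cl1.grade_apply]
  adjoint := by
    refine ⟨F, fun x y => ?_, fun a => ?_⟩
    · rw [weightedModule_inner, weightedModule_inner]
      congr 2
      refine ZeroAtInftyContinuousMap.ext fun q => ?_
      simp only [ZeroAtInftyContinuousMap.mul_apply, ZeroAtInftyContinuousMap.star_apply,
        mulOp_apply, hF]
      ext <;> simp [Cl1.σ, mul_left_comm, mul_comm]
    · have : (weightedModule e he hJ V p).left a * (F - F) = 0 :=
        (congrArg _ (sub_self F)).trans (mul_zero _)
      rw [this]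
      exact weightedModule_isCompactOp_zero e he hJ V p
  square a := by
    -- Here `σ ^ 2 = 1` turns the square of `m σ` into `m ^ 2`.
    have : F * F - 1 = mulOp f.toBCF := by
      refine LinearMap.ext fun ψ => ZeroAtInftyContinuousMap.ext fun q => ?_
      change F (F ψ) q - ψ q = f q * ψ q
      rw [hF, hF, hf]
      ext <;> simp [Cl1.σ] <;> ring
    rw [this]
    exact weightedModule_isCompactOp_left_mul e he hJ V p f a
  commutator a := by
    have : F * (weightedModule e he hJ V p).left a -
        (weightedModule e he hJ V p).left ((CStarGrading.trivial C(X, ℂ)).hom a) * F = 0 := by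
      refine LinearMap.ext fun ψ => ZeroAtInftyContinuousMap.ext fun q => ?_
      change F (pullMul p a ψ) q - pullMul p a (F ψ) q = 0
      rw [hF, pullMul_apply, pullMul_apply, hF]
      ext <;> simp [mul_left_comm]
    rw [this]
    exact weightedModule_isCompactOp_zero e he hJ V p

end WeightedModule

/-! ### Unbounded multiplication operators on their maximal domain. -/

section UnboundedMultiplication

open Topology BoundedContinuousFunction

/-- `S` is multiplication by `f σ` on its maximal domain in `C₀(P, Cl₁)`, for a continuous real
function `f` whose absolute value tends to infinity at infinity. -/
structure IsMaximalMul {P : Type*} [TopologicalSpace P] (S : C₀(P, Cl1) →ₗ.[ℂ] C₀(P, Cl1))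
    (f : P → ℝ) : Prop where
  continuous : Continuous f
  mem_domain : ∀ ψ φ : C₀(P, Cl1), (∀ q, φ q = f q • (Cl1.σ * ψ q)) → ψ ∈ S.domain
  apply : ∀ (ψ : S.domain) q, S ψ q = f q • (Cl1.σ * (ψ : C₀(P, Cl1)) q)
  proper : ∀ δ > 0, ∃ K : Set P, IsCompact K ∧ ∀ q, q ∉ K → (√(1 + f q ^ 2))⁻¹ < δ

namespace IsMaximalMul

section Bounded

variable {P : Type*} [TopologicalSpace P] {S : C₀(P, Cl1) →ₗ.[ℂ] C₀(P, Cl1)} {f : P → ℝ}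

theorem exists_apply_eq (hS : IsMaximalMul S f) {ψ φ : C₀(P, Cl1)}
    (h : ∀ q, φ q = f q • (Cl1.σ * ψ q)) : ∃ hψ : ψ ∈ S.domain, S ⟨ψ, hψ⟩ = φ :=
  ⟨hS.mem_domain ψ φ h, ZeroAtInftyContinuousMap.ext fun q => by rw [hS.apply, h]⟩

/-- The bounded function `(1 + f ^ 2)^(-1/2)`. -/
noncomputable def decay (hS : IsMaximalMul S f) : P →ᵇ ℝ :=
  BoundedContinuousFunction.ofNormedAddCommGroup (fun q => (√(1 + f q ^ 2))⁻¹)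
    ((by have := hS.continuous; fun_prop : Continuous fun q => √(1 + f q ^ 2)).inv₀
      fun q => by positivity) 1 fun q => by
    rw [Real.norm_eq_abs, abs_of_nonneg (by positivity)]
    exact inv_le_one_of_one_le₀ (Real.one_le_sqrt.2 (by nlinarith [sq_nonneg (f q)]))

theorem decay_apply (hS : IsMaximalMul S f) (q : P) : hS.decay q = (√(1 + f q ^ 2))⁻¹ := rfl

theorem decay_pos (hS : IsMaximalMul S f) (q : P) : 0 < hS.decay q := by
  rw [decay_apply]
  positivity

/-- The pointwise relation to which the identities for the resolvent, for the range of `1 + S ^ 2`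
and for the bounded transform reduce. -/
theorem decay_sq (hS : IsMaximalMul S f) (q : P) : hS.decay q ^ 2 * (1 + f q ^ 2) = 1 := by
  rw [decay_apply, inv_pow, Real.sq_sqrt (by positivity), inv_mul_cancel₀ (by positivity)]

/-- The bounded function `f (1 + f ^ 2)^(-1/2)`. -/
noncomputable def bdd (hS : IsMaximalMul S f) : P →ᵇ ℝ :=
  BoundedContinuousFunction.ofNormedAddCommGroup (fun q => f q * hS.decay q)
    (hS.continuous.mul hS.decay.continuous) 1 fun q => by
    rw [Real.norm_eq_abs, abs_le]
    have h := hS.decay_sq q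
    constructor <;> nlinarith [sq_nonneg (hS.decay q)]

theorem bdd_apply (hS : IsMaximalMul S f) (q : P) : hS.bdd q = f q * hS.decay q := rfl

/-- The function `(1 + f ^ 2)^(-1/2)` as an element of `C₀(P, Cl₁)`. -/
noncomputable def decayC0 (hS : IsMaximalMul S f) : C₀(P, Cl1) :=
  c0Mk (fun q => hS.decay q • (1 : Cl1)) (by fun_prop) fun δ hδ => by
    obtain ⟨K, hK, h⟩ := hS.proper δ hδ
    refine ⟨K, hK, fun q hq => ?_⟩
    rw [norm_smul, norm_one, mul_one, Real.norm_eq_abs, abs_of_pos (hS.decay_pos q)]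
    exact h q hq

theorem decayC0_apply (hS : IsMaximalMul S f) (q : P) :
    hS.decayC0 q = hS.decay q • (1 : Cl1) := rfl

/-- The bounded transform `f (1 + f ^ 2)^(-1/2) σ`. -/
noncomputable def transform (hS : IsMaximalMul S f) : C₀(P, Cl1) →ₗ[ℂ] C₀(P, Cl1) :=
  mulOp (BoundedContinuousFunction.const P Cl1.σ * realMult hS.bdd)

theorem transform_apply (hS : IsMaximalMul S f) (ψ : C₀(P, Cl1)) (q : P) :
    hS.transform ψ q = hS.bdd q • (Cl1.σ * ψ q) := by
  simp [transform]

/-- The function `(f σ + c)⁻¹ = (f σ - c) (1 + f ^ 2)⁻¹`, for `c ^ 2 = -1`. -/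
noncomputable def resolventC0 (hS : IsMaximalMul S f) (c : ℂ) : C₀(P, Cl1) :=
  -- One factor `decay` is spent on making `f σ - c` bounded, the other on decay at infinity.
  mulOp (BoundedContinuousFunction.const P Cl1.σ * realMult hS.bdd -
    BoundedContinuousFunction.const P (algebraMap ℂ Cl1 c) * realMult hS.decay) hS.decayC0

theorem resolventC0_apply (hS : IsMaximalMul S f) (c : ℂ) (q : P) :
    hS.resolventC0 c q = hS.decay q ^ 2 • (f q • Cl1.σ - algebraMap ℂ Cl1 c) := by
  simp only [resolventC0, mulOp_apply, decayC0_apply, BoundedContinuousFunction.sub_apply,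
    BoundedContinuousFunction.mul_apply, realMult_apply, bdd_apply,
    BoundedContinuousFunction.const_apply]
  ext <;> simp [Cl1.σ] <;> ring

/-- Since `σ ^ 2 = 1` and `c ^ 2 = -1`, the product `(f σ + c) (f σ - c)` is `f ^ 2 - c ^ 2 = 1 + f
^ 2`. -/
theorem mul_resolventC0 (hS : IsMaximalMul S f) {c : ℂ} (hc : c ^ 2 = -1) (q : P) :
    (f q • Cl1.σ + algebraMap ℂ Cl1 c) * hS.resolventC0 c q = 1 := by
  have h : (hS.decay q : ℂ) ^ 2 * (1 + (f q : ℂ) ^ 2) = 1 := by exact_mod_cast hS.decay_sq q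
  rw [resolventC0_apply]
  ext
  · simp [Cl1.σ]
    linear_combination h - (hS.decay q : ℂ) ^ 2 * hc
  · simp [Cl1.σ]
    linear_combination h - (hS.decay q : ℂ) ^ 2 * hc

theorem isResolvent (hS : IsMaximalMul S f) {c : ℂ} (hc : c ^ 2 = -1) :
    GradedBimodule.IsResolvent S c (mulOp (hS.resolventC0 c).toBCF) := by
  refine ⟨fun x => ?_, fun x => ZeroAtInftyContinuousMap.ext fun q => ?_⟩
  · obtain ⟨h, hx⟩ := hS.exists_apply_eq (ψ := mulOp (hS.resolventC0 c).toBCF x)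
      (φ := x - c • mulOp (hS.resolventC0 c).toBCF x) fun q => by
        change x q - c • (hS.resolventC0 c q * x q) = f q • (Cl1.σ * (hS.resolventC0 c q * x q))
        have h := hS.mul_resolventC0 hc q
        rw [Algebra.algebraMap_eq_smul_one] at h
        calc _ = ((f q • Cl1.σ + c • 1) * hS.resolventC0 c q) * x q -
              c • (hS.resolventC0 c q * x q) := by rw [h, one_mul]
          _ = _ := by
            simp only [add_mul, smul_mul_assoc, one_mul, mul_assoc]
            abel
    exact ⟨h, by rw [hx, sub_add_cancel]⟩
  · change hS.resolventC0 c q * (S x q + c • (x : C₀(P, Cl1)) q) = (x : C₀(P, Cl1)) q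
    have h := hS.mul_resolventC0 hc q
    rw [Algebra.algebraMap_eq_smul_one] at h
    rw [hS.apply]
    calc _ = ((f q • Cl1.σ + c • 1) * hS.resolventC0 c q) * (x : C₀(P, Cl1)) q := by
          rw [mul_comm (_ + _)]
          simp only [add_mul, smul_mul_assoc, one_mul, mul_assoc, mul_add, mul_smul_comm]
      _ = _ := by rw [h, one_mul]

/-- However large `f` is, it is continuous, so its product with a compactly supported function is
again in `C₀`. These vectors give density and serve as test functions for the adjoint. -/
theorem mem_domain_of_support (hS : IsMaximalMul S f) (ψ : C₀(P, Cl1)) {L : Set P}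
    (hL : IsCompact L) (h : ∀ q, q ∉ L → ψ q = 0) : ψ ∈ S.domain :=
  hS.mem_domain ψ (c0OfSupport (fun q => f q • (Cl1.σ * ψ q))
    (by have := hS.continuous; fun_prop) hL fun q hq => by rw [h q hq, mul_zero, smul_zero])
    fun q => rfl

end Bounded

variable {P Z X B : Type*} [TopologicalSpace P] [T2Space P] [LocallyCompactSpace P]
  [SigmaCompactSpace P] [TopologicalSpace Z] [T2Space Z] [TopologicalSpace X] [CompactSpace X]
  [NonUnitalCStarAlgebra B]
  {β : CStarGrading B} (e : B ≃⋆ₐ[ℂ] C₀(Z, Cl1))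
  (he : ∀ b, e (β.hom b) = (CStarGrading.c0Cl1 Z).hom (e b)) {J : P → Z}
  (hJ : IsOpenEmbedding J) (V : C0Weight P) (p : C(P, X))
  {S : C₀(P, Cl1) →ₗ.[ℂ] C₀(P, Cl1)} {f : P → ℝ}

theorem isDense_domain (hS : IsMaximalMul S f) :
    (weightedModule e he hJ V p).IsDense (S.domain : Set C₀(P, Cl1)) := fun ψ δ hδ => by
  obtain ⟨K, hK, h⟩ := (mulOp (realMult V.root) ψ).exists_isCompact_norm_sub_mul_le
    (half_pos hδ)
  obtain ⟨u, ⟨L, hL, huL⟩, h1, hu⟩ := exists_c0_cutoff hK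
  refine ⟨u * ψ, hS.mem_domain_of_support _ hL fun q hq => by
    rw [ZeroAtInftyContinuousMap.mul_apply, huL q hq, zero_mul], ?_⟩
  rw [weightedModule_norm, map_sub]
  have : mulOp (realMult V.root) (u * ψ) = u * mulOp (realMult V.root) ψ :=
    ZeroAtInftyContinuousMap.ext fun q => mul_left_comm _ _ _
  rw [this]
  linarith [h u h1 hu]

/-- Symmetry holds because `f` is real and `σ` self-adjoint. Conversely, pairing with a compactly
supported function equal to `1` at `q` forces `z q = f q σ y q`, and the maximal domain contains
every such `y`. -/
theorem isSelfAdjointOp (hS : IsMaximalMul S f) :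
    (weightedModule e he hJ V p).IsSelfAdjointOp S := by
  refine ⟨hS.isDense_domain e he hJ V p, fun y z => ⟨fun h => ?_, ?_⟩⟩
  · refine hS.exists_apply_eq fun q => ?_
    obtain ⟨u, ⟨L, hL, huL⟩, h1, hu⟩ := exists_c0_cutoff (isCompact_singleton (x := q))
    have h2 := h ⟨u, hS.mem_domain_of_support u hL huL⟩
    rw [weightedModule_inner, weightedModule_inner] at h2
    have h3 := congrArg (fun g : C₀(Z, Cl1) => g (J q)) (e.symm.injective h2)
    simp only [c0Extend_apply, ZeroAtInftyContinuousMap.mul_apply, mulOp_apply,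
      ZeroAtInftyContinuousMap.star_apply, hS.apply, h1 q rfl, realMult_apply] at h3
    have hV : V.inv q • (1 : Cl1) * (V.root q • (1 : Cl1)) = 1 := by
      rw [smul_mul_smul_comm, mul_comm, V.root_mul_inv, one_smul, one_mul]
    simp only [star_mul', star_smul, star_one, Cl1.star_σ, mul_one, star_trivial] at h3
    -- The tested identity `h3` carries the weight, i.e. the root twice; multiplying by the inverse
    -- root twice removes it.
    have h4 : z q = V.inv q • (1 : Cl1) * (V.inv q • (1 : Cl1)) *
        (V.root q • (1 : Cl1) * (V.root q • (1 : Cl1) * z q)) := by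
      linear_combination (-(1 + V.inv q • (1 : Cl1) * (V.root q • (1 : Cl1))) * z q) * hV
    rw [h4, ← h3, ← smul_mul_assoc]
    linear_combination ((1 + V.inv q • (1 : Cl1) * (V.root q • (1 : Cl1))) *
      (f q • Cl1.σ) * y q) * hV
  · rintro ⟨h, rfl⟩ x
    rw [weightedModule_inner, weightedModule_inner]
    congr 2
    refine ZeroAtInftyContinuousMap.ext fun q => ?_
    simp only [ZeroAtInftyContinuousMap.mul_apply, ZeroAtInftyContinuousMap.star_apply,
      mulOp_apply, hS.apply]
    ext <;> simp [Cl1.σ, mul_left_comm]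

theorem adjointAt_of_forall (hS : IsMaximalMul S f) {y z : C₀(P, Cl1)}
    (h : ∀ q, z q = f q • (Cl1.σ * y q)) : (weightedModule e he hJ V p).AdjointAt S y z :=
  ((hS.isSelfAdjointOp e he hJ V p).2 y z).2 (hS.exists_apply_eq h)

theorem isRegularOp (hS : IsMaximalMul S f) : (weightedModule e he hJ V p).IsRegularOp S where
  act_mem x b := hS.exists_apply_eq fun q => by
    rw [weightedModule_act, weightedModule_act, mulOp_apply, mulOp_apply, hS.apply]
    ext <;> simp [mul_left_comm]
  dense_domain := hS.isDense_domain e he hJ V p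
  closed x y h := by
    refine hS.exists_apply_eq fun q => ?_
    have hV : V.root q ≠ 0 := left_ne_zero_of_mul (by rw [V.root_mul_inv]; exact one_ne_zero)
    have hσ : ‖Cl1.σ‖ = 1 := by simp [Cl1.σ, Prod.norm_def]
    -- Closedness is checked one point at a time: the constant is unbounded in `q`, but `q` stays
    -- fixed while `δ` tends to zero.
    have key : ∀ δ > 0, |V.root q| * ‖y q - f q • (Cl1.σ * x q)‖ ≤ (1 + |f q|) * δ := by
      intro δ hδ
      obtain ⟨u, h1, h2⟩ := h δ hδ
      rw [weightedModule_norm] at h1 h2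
      have h1' := ((mulOp (realMult V.root) _).norm_apply_le q).trans h1.le
      have h2' := ((mulOp (realMult V.root) _).norm_apply_le q).trans h2.le
      rw [mulOp_apply, realMult_apply, smul_one_mul, norm_smul, Real.norm_eq_abs] at h1' h2'
      rw [ZeroAtInftyContinuousMap.sub_apply] at h1' h2'
      rw [hS.apply] at h2'
      have h3 : y q - f q • (Cl1.σ * x q) = f q • (Cl1.σ * ((u : C₀(P, Cl1)) q - x q)) -
          (f q • (Cl1.σ * (u : C₀(P, Cl1)) q) - y q) := by
        rw [mul_sub, smul_sub]
        abel
      have h4 : ‖f q • (Cl1.σ * ((u : C₀(P, Cl1)) q - x q))‖ ≤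
          |f q| * ‖(u : C₀(P, Cl1)) q - x q‖ := by
        rw [norm_smul, Real.norm_eq_abs]
        gcongr
        exact (norm_mul_le _ _).trans (by rw [hσ, one_mul])
      calc |V.root q| * ‖y q - f q • (Cl1.σ * x q)‖
          ≤ |V.root q| * (|f q| * ‖(u : C₀(P, Cl1)) q - x q‖ +
            ‖f q • (Cl1.σ * (u : C₀(P, Cl1)) q) - y q‖) := by
            gcongr
            rw [h3]
            exact (norm_sub_le _ _).trans (by gcongr)
        _ = |f q| * (|V.root q| * ‖(u : C₀(P, Cl1)) q - x q‖) +
            |V.root q| * ‖f q • (Cl1.σ * (u : C₀(P, Cl1)) q) - y q‖ := by ring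
        _ ≤ |f q| * δ + δ := by gcongr
        _ = (1 + |f q|) * δ := by ring
    have h0 : |V.root q| * ‖y q - f q • (Cl1.σ * x q)‖ ≤ 0 := by
      refine le_of_forall_pos_le_add fun η hη => ?_
      have := key (η / (1 + |f q|)) (by positivity)
      rwa [mul_div_cancel₀ _ (by positivity), ← zero_add η] at this
    have h1 : ‖y q - f q • (Cl1.σ * x q)‖ = 0 := by
      have hpos : 0 < |V.root q| := abs_pos.2 hV
      nlinarith [norm_nonneg (y q - f q • (Cl1.σ * x q))]
    exact sub_eq_zero.1 (norm_eq_zero.1 h1)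
  dense_adjoint ψ δ hδ := by
    obtain ⟨y, hy, h⟩ := hS.isDense_domain e he hJ V p ψ δ hδ
    exact ⟨y, ⟨S ⟨y, hy⟩, ((hS.isSelfAdjointOp e he hJ V p).2 _ _).2 ⟨hy, rfl⟩⟩, h⟩
  dense_range v δ hδ := by
    -- In fact `1 + S ^ 2` is onto: `v` is the image of `decay ^ 2 v`, because `decay ^ 2 + bdd ^ 2
    -- = 1`.
    obtain ⟨h, hx⟩ := hS.exists_apply_eq (ψ := mulOp (realMult hS.decay * realMult hS.decay) v)
      (φ := hS.transform (mulOp (realMult hS.decay) v)) fun q => by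
        rw [transform_apply, mulOp_apply, mulOp_apply, BoundedContinuousFunction.mul_apply,
          realMult_apply, bdd_apply]
        ext <;> simp [Cl1.σ] <;> ring
    refine ⟨v, ⟨⟨_, h⟩, hS.transform (hS.transform v), ?_, ?_⟩, ?_⟩
    · refine hS.adjointAt_of_forall e he hJ V p fun q => ?_
      rw [hx, transform_apply, transform_apply, transform_apply, mulOp_apply, realMult_apply,
        bdd_apply]
      ext <;> simp [Cl1.σ] <;> ring
    · refine ZeroAtInftyContinuousMap.ext fun q => ?_
      have h : (hS.decay q : ℂ) ^ 2 * (1 + (f q : ℂ) ^ 2) = 1 := by exact_mod_cast hS.decay_sq q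
      rw [ZeroAtInftyContinuousMap.add_apply, transform_apply, transform_apply, mulOp_apply,
        BoundedContinuousFunction.mul_apply, realMult_apply, bdd_apply]
      ext
      · simp [Cl1.σ]
        linear_combination (-(v q).1) * h
      · simp [Cl1.σ]
        linear_combination (-(v q).2) * h
    · rw [weightedModule_norm, sub_self, map_zero, norm_zero]
      exact hδ

theorem sq_eq_neg_one_of_eq_I {c : ℂ} (hc : c = Complex.I ∨ c = -Complex.I) : c ^ 2 = -1 := by
  rcases hc with rfl | rfl <;> simp

theorem hasCompactResolvent (hS : IsMaximalMul S f) :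
    (weightedModule e he hJ V p).HasCompactResolvent S := fun _ hc =>
  ⟨_, hS.isResolvent (sq_eq_neg_one_of_eq_I hc), weightedModule_isCompactOp_mulOp e he hJ V p _⟩

theorem isUnboundedKKCycle (hS : IsMaximalMul S f) :
    (weightedModule e he hJ V p).IsUnboundedKKCycle S where
  selfAdjoint := hS.isSelfAdjointOp e he hJ V p
  regular := hS.isRegularOp e he hJ V p
  odd x := hS.exists_apply_eq fun q => by
    rw [ZeroAtInftyContinuousMap.neg_apply, weightedModule_grade_apply, weightedModule_grade_apply,
      hS.apply]
    ext <;> simp [Cl1.σ, Cl1.grade_apply]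
  bounded_commutators a δ hδ := by
    -- No approximation is needed: every `a` preserves the domain and commutes with `S`.
    refine ⟨a, by rwa [sub_self, norm_zero], 0, 0, ?_, fun x => ?_⟩
    · simpa using weightedModule_isAdjointPair_mulOp e he hJ V p 0
    · obtain ⟨h, hx⟩ := hS.exists_apply_eq (ψ := pullMul p a x) (φ := pullMul p a (S x))
        fun q => by
          rw [pullMul_apply, pullMul_apply, hS.apply, mul_smul_comm, smul_comm]
      exact ⟨h, sub_eq_zero.2 hx⟩
  locally_compact_resolvent c hc :=
    ⟨_, hS.isResolvent (sq_eq_neg_one_of_eq_I hc),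
      weightedModule_isCompactOp_left_mul e he hJ V p _⟩

theorem isBoundedTransform (hS : IsMaximalMul S f) :
    (weightedModule e he hJ V p).IsBoundedTransform S hS.transform := by
  refine ⟨mulOp (realMult hS.decay), fun x => ?_, fun x => ?_, fun x => ?_⟩
  -- Positivity of the operator `decay` is witnessed by its own square root, applied to the vector
  -- multiplied by the root of the weight.
  · let r : P →ᵇ ℝ := BoundedContinuousFunction.ofNormedAddCommGroup (fun q => √(hS.decay q))
      (by fun_prop) √‖hS.decay‖ fun q => by
        rw [Real.norm_eq_abs, abs_of_nonneg (Real.sqrt_nonneg _)]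
        exact Real.sqrt_le_sqrt ((le_abs_self _).trans (hS.decay.norm_coe_le_norm q))
    refine ⟨e.symm (c0Extend hJ (mulOp (realMult r) (mulOp (realMult V.root) x))), ?_⟩
    rw [← map_star e.symm, ← map_mul e.symm, ← c0Extend_star, ← c0Extend_mul, weightedModule_inner]
    congr 2
    refine ZeroAtInftyContinuousMap.ext fun q => ?_
    have hr : (r q : ℂ) * r q = hS.decay q := by
      exact_mod_cast Real.mul_self_sqrt (hS.decay_pos q).le
    simp only [ZeroAtInftyContinuousMap.mul_apply, ZeroAtInftyContinuousMap.star_apply,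
      mulOp_apply, realMult_apply]
    ext <;> simp [← hr] <;> ring
  · obtain ⟨h, hx⟩ := hS.exists_apply_eq
      (ψ := mulOp (realMult hS.decay) (mulOp (realMult hS.decay) x))
      (φ := hS.transform (mulOp (realMult hS.decay) x)) fun q => by
        rw [transform_apply, mulOp_apply, mulOp_apply, realMult_apply, bdd_apply]
        ext <;> simp [Cl1.σ] <;> ring
    obtain ⟨h', hx'⟩ := hS.exists_apply_eq
      (ψ := hS.transform (mulOp (realMult hS.decay) x))
      (φ := hS.transform (hS.transform x)) fun q => by
        rw [transform_apply, transform_apply, transform_apply, mulOp_apply, realMult_apply,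
          bdd_apply]
        ext <;> simp [Cl1.σ] <;> ring
    refine ⟨h, hx ▸ h', ?_⟩
    simp only [hx, hx']
    refine ZeroAtInftyContinuousMap.ext fun q => ?_
    have h : (hS.decay q : ℂ) ^ 2 * (1 + (f q : ℂ) ^ 2) = 1 := by exact_mod_cast hS.decay_sq q
    rw [ZeroAtInftyContinuousMap.add_apply, transform_apply, transform_apply, mulOp_apply,
      mulOp_apply, realMult_apply, bdd_apply]
    ext
    · simp [Cl1.σ]
      linear_combination (x q).1 * h
    · simp [Cl1.σ]
      linear_combination (x q).2 * h
  · obtain ⟨h, hx⟩ := hS.exists_apply_eq (ψ := mulOp (realMult hS.decay) x)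
      (φ := hS.transform x) fun q => by
        rw [transform_apply, mulOp_apply, realMult_apply, bdd_apply]
        ext <;> simp [Cl1.σ] <;> ring
    exact ⟨h, hx.symm⟩

/-- The defect `bdd ^ 2 - 1` equals `-decay ^ 2`, which vanishes at infinity. -/
theorem isBoundedKKCycle_transform (hS : IsMaximalMul S f) :
    (weightedModule e he hJ V p).IsBoundedKKCycle hS.transform :=
  weightedModule_isBoundedKKCycle e he hJ V p hS.bdd (-(hS.decayC0 * hS.decayC0))
    (fun q => by
      have h := hS.decay_sq q
      rw [ZeroAtInftyContinuousMap.neg_apply, ZeroAtInftyContinuousMap.mul_apply, decayC0_apply,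
        smul_mul_smul_comm, one_mul, bdd_apply, ← neg_smul]
      congr 1
      linear_combination -h)
    _ hS.transform_apply

end IsMaximalMul

end UnboundedMultiplication

/-! ### Paths in `C₀(Y, Cl1)` as functions on the cylinder over `Y`. -/

section Cylinder

open Topology BoundedContinuousFunction

variable {Y : Type*} [TopologicalSpace Y]

theorem continuous_cylinder_uncurry (f : C(unitInterval, C₀(Y, Cl1))) :
    Continuous fun q : unitInterval × Y => f q.1 q.2 := by
  refine continuous_iff_continuousAt.2 fun q => Metric.tendsto_nhds.2 fun δ hδ => ?_
  have h1 : ∀ᶠ q' : unitInterval × Y in 𝓝 q, ‖f q'.1 - f q.1‖ < δ / 2 := by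
    have := (f.continuous.comp continuous_fst).continuousAt (x := q)
    filter_upwards [Metric.tendsto_nhds.1 this (δ / 2) (by positivity)] with q' hq'
    simpa [dist_eq_norm] using hq'
  have h2 : ∀ᶠ q' : unitInterval × Y in 𝓝 q, ‖f q.1 q'.2 - f q.1 q.2‖ < δ / 2 := by
    have := ((f q.1).continuous.comp continuous_snd).continuousAt (x := q)
    filter_upwards [Metric.tendsto_nhds.1 this (δ / 2) (by positivity)] with q' hq'
    simpa [dist_eq_norm] using hq'
  filter_upwards [h1, h2] with q' h1 h2
  rw [dist_eq_norm]
  calc ‖f q'.1 q'.2 - f q.1 q.2‖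
      = ‖(f q'.1 - f q.1) q'.2 + (f q.1 q'.2 - f q.1 q.2)‖ := by
        rw [ZeroAtInftyContinuousMap.sub_apply, sub_add_sub_cancel]
    _ ≤ ‖(f q'.1 - f q.1) q'.2‖ + ‖f q.1 q'.2 - f q.1 q.2‖ := norm_add_le _ _
    _ < δ := by linarith [(f q'.1 - f q.1).norm_apply_le q'.2]

/-- By compactness of the interval, finitely many of the functions `f t` approximate all the others
within `δ / 2`; the union of their compact sets works for every `t`. -/
theorem exists_isCompact_cylinder_norm_lt (f : C(unitInterval, C₀(Y, Cl1))) {δ : ℝ} (hδ : 0 < δ) :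
    ∃ K : Set Y, IsCompact K ∧ ∀ t y, y ∉ K → ‖f t y‖ < δ := by
  choose K hK h using fun t => (f t).exists_isCompact_norm_lt (half_pos hδ)
  have hU : ∀ t, {t' | ‖f t' - f t‖ < δ / 2} ∈ 𝓝 t := fun t => by
    filter_upwards [Metric.tendsto_nhds.1 f.continuous.continuousAt (δ / 2) (half_pos hδ)] with t' h
    simpa [dist_eq_norm] using h
  obtain ⟨s, hs⟩ := (CompactSpace.isCompact_univ (X := unitInterval)).elim_nhds_subcover _
    fun t _ => hU t
  refine ⟨⋃ t ∈ s, K t, s.isCompact_biUnion fun t _ => hK t, fun t y hy => ?_⟩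
  obtain ⟨t', ht', htt'⟩ := Set.mem_iUnion₂.1 (hs.2 (Set.mem_univ t))
  have hy' : y ∉ K t' := fun hy' => hy (Set.mem_biUnion ht' hy')
  calc ‖f t y‖ = ‖(f t - f t') y + f t' y‖ := by
        rw [ZeroAtInftyContinuousMap.sub_apply, sub_add_cancel]
    _ ≤ ‖(f t - f t') y‖ + ‖f t' y‖ := norm_add_le _ _
    _ < δ := by
      have h1 : ‖f t - f t'‖ < δ / 2 := htt'
      linarith [(f t - f t').norm_apply_le y, h t' y hy']

/-- The slice `g(t, ·)` of `g ∈ C₀([0,1] × Y, Cl₁)`. -/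
noncomputable def c0Slice (g : C₀(unitInterval × Y, Cl1)) (t : unitInterval) : C₀(Y, Cl1) :=
  c0Mk (fun y => g (t, y)) (by fun_prop) fun δ hδ => by
    obtain ⟨K, hK, h⟩ := g.exists_isCompact_norm_lt hδ
    exact ⟨Prod.snd '' K, hK.image continuous_snd, fun y hy => h _ fun hK => hy ⟨_, hK, rfl⟩⟩

/-- Over the compact projection of `K` the slices converge uniformly by a tube argument; elsewhere
both are below `δ / 4`, so their difference is at most `δ / 2`. -/
theorem continuous_c0Slice (g : C₀(unitInterval × Y, Cl1)) : Continuous (c0Slice g) := by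
  refine continuous_iff_continuousAt.2 fun t => Metric.tendsto_nhds.2 fun δ hδ => ?_
  obtain ⟨K, hK, h⟩ := g.exists_isCompact_norm_lt (δ := δ / 4) (by positivity)
  have hL : IsCompact (Prod.snd '' K) := hK.image continuous_snd
  have hev : ∀ᶠ t' in 𝓝 t, ∀ y ∈ Prod.snd '' K, ‖g (t', y) - g (t, y)‖ < δ / 2 := by
    refine hL.eventually_forall_of_forall_eventually fun y _ => ?_
    have hc : Continuous fun q : unitInterval × Y => ‖g q - g (t, q.2)‖ := by fun_prop
    have := hc.tendsto (t, y)
    simp only [sub_self, norm_zero] at this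
    exact this.eventually (gt_mem_nhds (half_pos hδ))
  filter_upwards [hev] with t' ht'
  rw [dist_eq_norm]
  refine lt_of_le_of_lt (ZeroAtInftyContinuousMap.norm_le_of_forall _ (half_pos hδ).le fun y => ?_)
    (half_lt_self hδ)
  change ‖g (t', y) - g (t, y)‖ ≤ δ / 2
  by_cases hy : y ∈ Prod.snd '' K
  · exact (ht' y hy).le
  · have h1 := h (t', y) fun hK => hy ⟨_, hK, rfl⟩
    have h2 := h (t, y) fun hK => hy ⟨_, hK, rfl⟩
    linarith [norm_sub_le (g (t', y)) (g (t, y))]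

/-- The identification `C([0,1], C₀(Y, Cl₁)) ≅ C₀([0,1] × Y, Cl₁)`. -/
noncomputable def cylinderEquiv (Y : Type*) [TopologicalSpace Y] :
    C(unitInterval, C₀(Y, Cl1)) ≃⋆ₐ[ℂ] C₀(unitInterval × Y, Cl1) where
  toFun f := c0Mk (fun q => f q.1 q.2) (continuous_cylinder_uncurry f) fun δ hδ => by
    obtain ⟨K, hK, h⟩ := exists_isCompact_cylinder_norm_lt f hδ
    exact ⟨Set.univ ×ˢ K, isCompact_univ.prod hK, fun q hq => h _ _ fun hK => hq ⟨trivial, hK⟩⟩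
  invFun g := ⟨c0Slice g, continuous_c0Slice g⟩
  left_inv f := by ext t y <;> rfl
  right_inv g := by ext q <;> rfl
  map_mul' f g := by ext q <;> rfl
  map_add' f g := by ext q <;> rfl
  map_star' f := by ext q <;> rfl
  map_smul' c f := by ext q <;> rfl

theorem cylinderEquiv_apply (f : C(unitInterval, C₀(Y, Cl1))) (t : unitInterval) (y : Y) :
    cylinderEquiv Y f (t, y) = f t y := rfl

end Cylinder

/-! ### Weights from bounded functions, and restriction to open subsets of compact sets. -/

section Weights

open Topology BoundedContinuousFunction

variable {P : Type*} [TopologicalSpace P]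

/-- The weight given by a continuous function between positive constants. -/
noncomputable def C0Weight.ofBounds (w : P → ℝ) (hw : Continuous w) {c C : ℝ} (hc : 0 < c)
    (h : ∀ q, c ≤ w q ∧ w q ≤ C) : C0Weight P where
  root := BoundedContinuousFunction.ofNormedAddCommGroup (fun q => √(w q)) (by fun_prop) √C
    fun q => by
      rw [Real.norm_eq_abs, abs_of_nonneg (Real.sqrt_nonneg _)]
      exact Real.sqrt_le_sqrt (h q).2
  inv := BoundedContinuousFunction.ofNormedAddCommGroup (fun q => (√(w q))⁻¹)
    (hw.sqrt.inv₀ fun q => (Real.sqrt_pos.2 (hc.trans_le (h q).1)).ne') (√c)⁻¹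
    fun q => by
      rw [Real.norm_eq_abs, abs_of_nonneg (by positivity)]
      exact inv_anti₀ (Real.sqrt_pos.2 hc) (Real.sqrt_le_sqrt (h q).1)
  root_mul_inv q := mul_inv_cancel₀ (Real.sqrt_pos.2 (hc.trans_le (h q).1)).ne'

theorem C0Weight.ofBounds_root_mul_self (w : P → ℝ) (hw : Continuous w) {c C : ℝ} (hc : 0 < c)
    (h : ∀ q, c ≤ w q ∧ w q ≤ C) (q : P) :
    (C0Weight.ofBounds w hw hc h).root q * (C0Weight.ofBounds w hw hc h).root q = w q :=
  Real.mul_self_sqrt (hc.le.trans (h q).1)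

/-- Restriction along an embedding into a compact set of a continuous function which vanishes on
the rest of that compact set. -/
def c0Pull {Q : Type*} [TopologicalSpace Q] {i : P → Q} (hi : IsEmbedding i) {D : Set Q}
    (hD : IsCompact D) (hr : ∀ q, i q ∈ D) (g : Q → Cl1) (hg : Continuous g)
    (h0 : ∀ q ∈ D, q ∉ Set.range i → g q = 0) : C₀(P, Cl1) :=
  c0Mk (fun q => g (i q)) (hg.comp hi.continuous) fun δ hδ => by
    -- The part of `D` where `g` is at least `δ` is compact and contained in the range of `i`, so
    -- its preimage is compact.
    refine ⟨i ⁻¹' (D ∩ {q | δ ≤ ‖g q‖}), ?_, fun q hq => ?_⟩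
    · refine hi.isInducing.isCompact_preimage' (hD.inter_right (isClosed_le continuous_const
        hg.norm)) fun q hq => ?_
      by_contra hq'
      have : δ ≤ ‖g q‖ := hq.2
      rw [h0 q hq.1 hq', norm_zero] at this
      linarith
    · by_contra h
      exact hq ⟨hr q, not_lt.1 h⟩

theorem c0Pull_apply {Q : Type*} [TopologicalSpace Q] {i : P → Q} (hi : IsEmbedding i) {D : Set Q}
    (hD : IsCompact D) (hr : ∀ q, i q ∈ D) (g : Q → Cl1) (hg : Continuous g)
    (h0 : ∀ q ∈ D, q ∉ Set.range i → g q = 0) (q : P) : c0Pull hi hD hr g hg h0 q = g (i q) := rfl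

variable {Z X B : Type*} [T2Space P] [LocallyCompactSpace P]
  [SigmaCompactSpace P] [TopologicalSpace Z] [T2Space Z] [TopologicalSpace X] [CompactSpace X]
  [NonUnitalCStarAlgebra B]
  {β : CStarGrading B} (e : B ≃⋆ₐ[ℂ] C₀(Z, Cl1))
  (he : ∀ b, e (β.hom b) = (CStarGrading.c0Cl1 Z).hom (e b)) {J : P → Z}
  (hJ : IsOpenEmbedding J) (V : C0Weight P) (p : C(P, X))

theorem weightedModule_inner_apply (ψ φ : C₀(P, Cl1)) (q : P) :
    e ((weightedModule e he hJ V p).inner ψ φ) (J q) =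
      (V.root q * V.root q) • (star (ψ q) * φ q) := by
  rw [weightedModule_inner, StarAlgEquiv.apply_symm_apply, c0Extend_apply,
    ZeroAtInftyContinuousMap.mul_apply, ZeroAtInftyContinuousMap.star_apply, mulOp_apply,
    mulOp_apply, realMult_apply]
  ext <;> simp <;> ring

theorem weightedModule_inner_apply_of_forall_ne (ψ φ : C₀(P, Cl1)) {z : Z} (hz : ∀ q, z ≠ J q) :
    e ((weightedModule e he hJ V p).inner ψ φ) z = 0 := by
  rw [weightedModule_inner, StarAlgEquiv.apply_symm_apply, c0Extend_apply_of_forall_ne hJ _ hz]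

end Weights

/-! ### The homotopy between tubes of different radius, weight and profile. -/

section TubeHomotopy

open Topology BoundedContinuousFunction

/-- The inclusion of the tube of radius `ε` in `X × ℝ`. -/
def tubeIncl (X : Type*) (ε : ℝ) (q : X × Set.Ioo (-ε) ε) : X × ℝ := (q.1, q.2)

theorem isOpenEmbedding_tubeIncl (X : Type*) [TopologicalSpace X] (ε : ℝ) :
    IsOpenEmbedding (tubeIncl X ε) :=
  IsOpenEmbedding.id.prodMap isOpen_Ioo.isOpenEmbedding_subtypeVal

theorem mem_range_tubeIncl {X : Type*} {ε : ℝ} {q : X × ℝ} :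
    q ∈ Set.range (tubeIncl X ε) ↔ |q.2| < ε := by
  rw [abs_lt]
  exact ⟨by rintro ⟨p, rfl⟩; exact p.2.2, fun h => ⟨(q.1, ⟨q.2, h⟩), rfl⟩⟩

variable {X Y : Type*} [TopologicalSpace X] [TopologicalSpace Y]

theorem isOpenEmbedding_tube_of_le {j : X × ℝ → Y} {ε R : ℝ} (h : ε ≤ R)
    (hj : IsOpenEmbedding fun q : X × Set.Ioo (-R) R => j (q.1, q.2)) :
    IsOpenEmbedding fun q : X × Set.Ioo (-ε) ε => j (q.1, q.2) := by
  have hsub : Set.Ioo (-ε) ε ⊆ Set.Ioo (-R) R := Set.Ioo_subset_Ioo (neg_le_neg h) h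
  have h1 : IsOpenEmbedding fun q : X × Set.Ioo (-ε) ε =>
      ((q.1, Set.inclusion hsub q.2) : X × Set.Ioo (-R) R) :=
    IsOpenEmbedding.of_comp _ (isOpenEmbedding_tubeIncl X R) (isOpenEmbedding_tubeIncl X ε)
  exact hj.comp h1

/-- The radius at time `t` of the homotopy of tubes. -/
noncomputable def tubeRadius (ε r : ℝ) (t : unitInterval) : ℝ := (1 - t) * ε + t * r

theorem continuous_tubeRadius (ε r : ℝ) : Continuous (tubeRadius ε r) := by
  unfold tubeRadius
  fun_prop

theorem tubeRadius_pos {ε r : ℝ} (hε : 0 < ε) (hr : 0 < r) (t : unitInterval) :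
    0 < tubeRadius ε r t := by
  have h0 := t.2.1
  have h1 := t.2.2
  unfold tubeRadius
  rcases h0.eq_or_lt with h | h
  · rw [← h]
    linarith
  · have : 0 ≤ (1 - (t : ℝ)) * ε := mul_nonneg (by linarith) hε.le
    have : 0 < (t : ℝ) * r := mul_pos h hr
    linarith

theorem tubeRadius_lt {ε r R : ℝ} (hε : ε < R) (hr : r < R) (t : unitInterval) :
    tubeRadius ε r t < R := by
  -- `R` minus the radius is the interpolation between `R - ε` and `R - r`.
  have h := tubeRadius_pos (sub_pos.2 hε) (sub_pos.2 hr) t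
  unfold tubeRadius at *
  linarith

/-- The track of the homotopy of tubes. -/
abbrev TubeTrack (X : Type*) (ε r : ℝ) : Type _ :=
  {q : unitInterval × X × ℝ // |q.2.2| < tubeRadius ε r q.1}

theorem eq_or_eq_neg_of_closedTrack {X : Type*} {ε r : ℝ} {q : unitInterval × X × ℝ}
    (h : |q.2.2| ≤ tubeRadius ε r q.1)
    (h' : q ∉ Set.range (Subtype.val : TubeTrack X ε r → unitInterval × X × ℝ)) :
    q.2.2 = tubeRadius ε r q.1 ∨ q.2.2 = -tubeRadius ε r q.1 :=
  eq_or_eq_neg_of_abs_eq (h.antisymm (not_lt.1 fun h => h' ⟨⟨q, h⟩, rfl⟩))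

theorem isOpen_tubeTrack (ε r : ℝ) :
    IsOpen {q : unitInterval × X × ℝ | |q.2.2| < tubeRadius ε r q.1} :=
  isOpen_lt (by fun_prop) ((continuous_tubeRadius ε r).comp continuous_fst)

theorem isOpenEmbedding_tubeTrack_val (ε r : ℝ) :
    IsOpenEmbedding (Subtype.val : TubeTrack X ε r → unitInterval × X × ℝ) :=
  (isOpen_tubeTrack ε r).isOpenEmbedding_subtypeVal

/-- The tube map on the track. -/
def trackMap (j : X × ℝ → Y) (ε r : ℝ) (q : TubeTrack X ε r) : unitInterval × Y :=
  (q.1.1, j q.1.2)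

/-- All radii stay below `R`, so the track is an open part of `[0,1] × X × (-R, R)`, on which `id ×
j` is an open embedding. -/
theorem isOpenEmbedding_trackMap {j : X × ℝ → Y} {ε r R : ℝ} (hε : ε < R) (hr : r < R)
    (hj : IsOpenEmbedding fun q : X × Set.Ioo (-R) R => j (q.1, q.2)) :
    IsOpenEmbedding (trackMap j ε r) := by
  have hk : ∀ q : TubeTrack X ε r, q.1.2.2 ∈ Set.Ioo (-R) R := fun q =>
    abs_lt.1 (q.2.trans (tubeRadius_lt hε hr _))
  have h1 : IsOpenEmbedding fun q : TubeTrack X ε r =>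
      ((q.1.1, q.1.2.1, ⟨q.1.2.2, hk q⟩) : unitInterval × X × Set.Ioo (-R) R) :=
    IsOpenEmbedding.of_comp _ (IsOpenEmbedding.id.prodMap (isOpenEmbedding_tubeIncl X R))
      (isOpenEmbedding_tubeTrack_val ε r)
  exact (IsOpenEmbedding.id.prodMap hj).comp h1

variable [CompactSpace X]

theorem isCompact_closedTrack (ε r : ℝ) :
    IsCompact {q : unitInterval × X × ℝ | |q.2.2| ≤ tubeRadius ε r q.1} := by
  obtain ⟨C, hC⟩ := (isCompact_range (continuous_tubeRadius ε r)).bddAbove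
  refine IsCompact.of_isClosed_subset (isCompact_univ.prod (isCompact_univ.prod
    (isCompact_Icc (a := -C) (b := C)))) (isClosed_le (by fun_prop)
      ((continuous_tubeRadius ε r).comp continuous_fst)) fun q hq => ?_
  have : |q.2.2| ≤ C := le_trans hq (hC ⟨q.1, rfl⟩)
  exact ⟨trivial, trivial, abs_le.1 this⟩

theorem isCompact_closedTube (ε : ℝ) :
    IsCompact {q : X × ℝ | |q.2| ≤ ε} := by
  have : {q : X × ℝ | |q.2| ≤ ε} = Set.univ ×ˢ Set.Icc (-ε) ε := by
    ext q
    simp [abs_le]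
  rw [this]
  exact isCompact_univ.prod isCompact_Icc

variable [T2Space X]

instance (ε r : ℝ) : LocallyCompactSpace (TubeTrack X ε r) :=
  (isOpen_tubeTrack ε r).locallyCompactSpace

instance [SecondCountableTopology X] (ε r : ℝ) : SigmaCompactSpace (TubeTrack X ε r) :=
  have := (isOpenEmbedding_tubeTrack_val (X := X) ε r).isInducing.secondCountableTopology
  inferInstance

/-- Evaluation at time `t` of functions on the track. -/
noncomputable def trackEval {ε r ε' : ℝ} {t : unitInterval} (ht : tubeRadius ε r t = ε') :
    C₀(TubeTrack X ε r, Cl1) →ₗ[ℂ] TubeSections X ε' :=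
  have hmem : ∀ p : X × Set.Ioo (-ε') ε', |(p.2 : ℝ)| < tubeRadius ε r t :=
    fun p => ht.symm ▸ abs_lt.2 p.2.2
  -- Decay at `±ε'` comes from extending `ψ` by zero beyond the track and restricting to the slice;
  -- `copy` then makes the evaluation formula definitional.
  { toFun := fun ψ => (c0Pull (isOpenEmbedding_tubeIncl X ε').isEmbedding
        (isCompact_closedTube ε') (fun q => (abs_lt.2 q.2.2).le)
        (fun q => c0Extend (isOpenEmbedding_tubeTrack_val ε r) ψ (t, q)) (by fun_prop)
        fun q _ hq => c0Extend_apply_of_forall_ne _ _ fun q' hq' => hq <| by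
          rw [mem_range_tubeIncl, ← ht]
          have := q'.2
          rwa [← hq'] at this).copy (fun p => ψ ⟨(t, p.1, p.2), hmem p⟩) <| funext fun p =>
            (c0Extend_apply (isOpenEmbedding_tubeTrack_val ε r) ψ ⟨(t, p.1, p.2), hmem p⟩).symm
    map_add' := fun ψ φ => rfl
    map_smul' := fun c ψ => rfl }

theorem trackEval_apply {ε r ε' : ℝ} {t : unitInterval} (ht : tubeRadius ε r t = ε')
    (ψ : C₀(TubeTrack X ε r, Cl1)) (p : X × Set.Ioo (-ε') ε')
    (hp : |(p.2 : ℝ)| < tubeRadius ε r t) : trackEval ht ψ p = ψ ⟨(t, p.1, p.2), hp⟩ := rfl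

/-- A function on the slice is spread over the whole track by rescaling the normal coordinate to the
current radius; at time `t` the rescaling is the identity. -/
theorem trackEval_surjective {ε r ε' : ℝ} {t : unitInterval} (hε : 0 < ε) (hr : 0 < r)
    (ht : tubeRadius ε r t = ε') : Function.Surjective (trackEval (X := X) ht) := fun φ => by
  have hpos : ∀ t, tubeRadius ε r t ≠ 0 := fun t => (tubeRadius_pos hε hr t).ne'
  have hc : Continuous fun q : unitInterval × X × ℝ => q.2.2 * ε' / tubeRadius ε r q.1 :=
    Continuous.div (by fun_prop) ((continuous_tubeRadius ε r).comp continuous_fst)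
      fun q => hpos q.1
  refine ⟨c0Pull (isOpenEmbedding_tubeTrack_val ε r).isEmbedding (isCompact_closedTrack ε r)
    (fun q => q.2.le) (fun q => c0Extend (isOpenEmbedding_tubeIncl X ε') φ
      (q.2.1, q.2.2 * ε' / tubeRadius ε r q.1))
    ((c0Extend (isOpenEmbedding_tubeIncl X ε') φ).continuous.comp (by fun_prop))
    fun q hq hq' => c0Extend_apply_of_forall_ne _ _ fun p hp => ?_,
    ZeroAtInftyContinuousMap.ext fun p => ?_⟩
  · have h2 : q.2.2 * ε' / tubeRadius ε r q.1 = p.2 := congrArg Prod.snd hp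
    have h3 := abs_lt.2 p.2.2
    rw [← h2] at h3
    have h0 : 0 < ε' := ht ▸ tubeRadius_pos hε hr t
    rcases eq_or_eq_neg_of_closedTrack hq hq' with h | h
    · rw [h, mul_div_cancel_left₀ _ (hpos _), abs_of_pos h0] at h3
      exact lt_irrefl _ h3
    · rw [h, neg_mul, neg_div, mul_div_cancel_left₀ _ (hpos _), abs_neg, abs_of_pos h0] at h3
      exact lt_irrefl _ h3
  · have hp : |(p.2 : ℝ)| < tubeRadius ε r t := ht.symm ▸ abs_lt.2 p.2.2
    rw [trackEval_apply ht _ p hp, c0Pull_apply]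
    change c0Extend _ φ (p.1, p.2 * ε' / tubeRadius ε r t) = _
    have hp' : (p.2 : ℝ) * ε' / tubeRadius ε r t = p.2 := by
      rw [ht, mul_div_cancel_right₀ _ (ht ▸ hpos t)]
    rw [hp']
    exact c0Extend_apply (isOpenEmbedding_tubeIncl X _) φ p

variable [SecondCountableTopology X] [T2Space Y]

/-- The evaluation at `t` of a weighted module over the track. -/
theorem isEvaluation_track {j : X × ℝ → Y} {ε r ε' : ℝ} {t : unitInterval} (hε : 0 < ε)
    (hr : 0 < r) (ht : tubeRadius ε r t = ε') (hJ : IsOpenEmbedding (trackMap j ε r))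
    (V : C0Weight (TubeTrack X ε r))
    (he : ∀ b, cylinderEquiv Y ((CStarGrading.c0Cl1 Y).cylinder.hom b) =
      (CStarGrading.c0Cl1 _).hom (cylinderEquiv Y b))
    {p : C(TubeTrack X ε r, X)} (hp : ∀ q, p q = q.1.2.1)
    {F : C₀(TubeTrack X ε r, Cl1) →ₗ[ℂ] C₀(TubeTrack X ε r, Cl1)} {m : TubeTrack X ε r → ℝ}
    (hF : ∀ ψ q, F ψ q = m q • (Cl1.σ * ψ q))
    {w : X × ℝ → ℝ} {M₀ : GradedBimodule (CStarGrading.trivial C(X, ℂ)) (CStarGrading.c0Cl1 Y)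
      (TubeSections X ε')} (hM₀ : IsTubeModule j w ε' M₀)
    (hw : ∀ q : TubeTrack X ε r, q.1.1 = t → V.root q * V.root q = w q.1.2)
    {F₀ : TubeSections X ε' →ₗ[ℂ] TubeSections X ε'} {m₀ : ℝ → ℝ}
    (hF₀ : ∀ ψ p, F₀ ψ p = m₀ p.2 • (Cl1.σ * ψ p))
    (hm : ∀ q : TubeTrack X ε r, q.1.1 = t → m q = m₀ q.1.2.2) :
    (weightedModule (cylinderEquiv Y) he hJ V p).IsEvaluation F t M₀ F₀ := by
  have hmem : ∀ p : X × Set.Ioo (-ε') ε', |(p.2 : ℝ)| < tubeRadius ε r t :=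
    fun p => ht.symm ▸ abs_lt.2 p.2.2
  refine ⟨trackEval ht, trackEval_surjective hε hr ht, fun x y => ?_, fun x b => ?_, fun a x => ?_,
    fun x => ?_, fun x => ?_⟩
  · refine ZeroAtInftyContinuousMap.ext fun z => ?_
    rw [← cylinderEquiv_apply]
    by_cases hz : ∃ p : X × Set.Ioo (-ε') ε', z = j (p.1, p.2)
    · obtain ⟨p', rfl⟩ := hz
      rw [hM₀.inner]
      have h := weightedModule_inner_apply (B := C(unitInterval, C₀(Y, Cl1))) (cylinderEquiv Y) he
        hJ V p x y ⟨(t, p'.1, p'.2), hmem p'⟩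
      rw [hw _ rfl] at h
      exact h.symm
    -- A point outside the tube of radius `ε'` gives a point `(t, z)` outside the range of the
    -- track, where both inner products vanish.
    · push Not at hz
      rw [hM₀.inner_off _ _ _ hz]
      refine (weightedModule_inner_apply_of_forall_ne (B := C(unitInterval, C₀(Y, Cl1)))
        (cylinderEquiv Y) he hJ V p x y fun q hq => ?_).symm
      have h1 : t = q.1.1 := congrArg Prod.fst hq
      have h2 : z = j q.1.2 := congrArg Prod.snd hq
      have h3 := q.2
      rw [← h1, ht] at h3
      exact hz (q.1.2.1, ⟨q.1.2.2, abs_lt.1 h3⟩) h2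
  · refine ZeroAtInftyContinuousMap.ext fun p' => ?_
    rw [hM₀.act, trackEval_apply ht _ p' (hmem p'), trackEval_apply ht _ p' (hmem p'),
      weightedModule_act, mulOp_apply, mul_comm]
    rfl
  · refine ZeroAtInftyContinuousMap.ext fun p' => ?_
    rw [hM₀.left, trackEval_apply ht _ p' (hmem p'), trackEval_apply ht _ p' (hmem p'),
      weightedModule_left, pullMul_apply, hp]
  · refine ZeroAtInftyContinuousMap.ext fun p' => ?_
    rw [hM₀.grade, trackEval_apply ht _ p' (hmem p'), trackEval_apply ht _ p' (hmem p'),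
      weightedModule_grade_apply]
  · refine ZeroAtInftyContinuousMap.ext fun p' => ?_
    rw [hF₀, trackEval_apply ht _ p' (hmem p'), trackEval_apply ht _ p' (hmem p'), hF, hm _ rfl]

/-- Any two tube cycles given by weights and profiles interpolating between `-1` and `1` are
homotopic. -/
theorem sameKKClass_tube {j : X × ℝ → Y} {ε r R : ℝ} (hε : 0 < ε) (hr : 0 < r) (hεR : ε < R)
    (hrR : r < R) (hj : IsOpenEmbedding fun q : X × Set.Ioo (-R) R => j (q.1, q.2))
    {w₀ w₁ : X × ℝ → ℝ} (hw₀ : ContinuousOn w₀ {q | |q.2| < R})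
    (hw₁ : ContinuousOn w₁ {q | |q.2| < R}) {c C : ℝ} (hc : 0 < c)
    (hb₀ : ∀ q, |q.2| < R → c ≤ w₀ q ∧ w₀ q ≤ C) (hb₁ : ∀ q, |q.2| < R → c ≤ w₁ q ∧ w₁ q ≤ C)
    {χ₀ χ₁ : ℝ → ℝ} (hχ₀ : Continuous χ₀) (hχ₁ : Continuous χ₁) (h₀ : χ₀ ε = 1)
    (h₀' : χ₀ (-ε) = -1) (h₁ : χ₁ r = 1) (h₁' : χ₁ (-r) = -1)
    {M₀ : GradedBimodule (CStarGrading.trivial C(X, ℂ)) (CStarGrading.c0Cl1 Y) (TubeSections X ε)}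
    (hM₀ : IsTubeModule j w₀ ε M₀)
    {M₁ : GradedBimodule (CStarGrading.trivial C(X, ℂ)) (CStarGrading.c0Cl1 Y) (TubeSections X r)}
    (hM₁ : IsTubeModule j w₁ r M₁) {F₀ : TubeSections X ε →ₗ[ℂ] TubeSections X ε}
    {F₁ : TubeSections X r →ₗ[ℂ] TubeSections X r}
    (hF₀ : ∀ ψ p, F₀ ψ p = (-χ₀ p.2) • (Cl1.σ * ψ p))
    (hF₁ : ∀ ψ p, F₁ ψ p = (-χ₁ p.2) • (Cl1.σ * ψ p)) : SameKKClass M₀ F₀ M₁ F₁ := by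
  have hpos : ∀ t, tubeRadius ε r t ≠ 0 := fun t => (tubeRadius_pos hε hr t).ne'
  have hlt : ∀ q : TubeTrack X ε r, |q.1.2.2| < R := fun q => q.2.trans (tubeRadius_lt hεR hrR _)
  have hmaps : Continuous fun q : TubeTrack X ε r => q.1.2 := by fun_prop
  have hW : Continuous fun q : TubeTrack X ε r =>
      (1 - (q.1.1 : ℝ)) * w₀ q.1.2 + q.1.1 * w₁ q.1.2 := by
    have h1 : Continuous fun q : TubeTrack X ε r => w₀ q.1.2 := hw₀.comp_continuous hmaps hlt
    have h2 : Continuous fun q : TubeTrack X ε r => w₁ q.1.2 := hw₁.comp_continuous hmaps hlt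
    have h3 : Continuous fun q : TubeTrack X ε r => (q.1.1 : ℝ) := by fun_prop
    exact ((continuous_const.sub h3).mul h1).add (h3.mul h2)
  have hWb : ∀ q : TubeTrack X ε r, c ≤ (1 - (q.1.1 : ℝ)) * w₀ q.1.2 + q.1.1 * w₁ q.1.2 ∧
      (1 - (q.1.1 : ℝ)) * w₀ q.1.2 + q.1.1 * w₁ q.1.2 ≤ C := fun q => by
    have ht0 := q.1.1.2.1
    have ht1 := q.1.1.2.2
    obtain ⟨a0, b0⟩ := hb₀ _ (hlt q)
    obtain ⟨a1, b1⟩ := hb₁ _ (hlt q)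
    constructor <;> nlinarith
  -- After rescaling, both profiles take the same value `±1` at the boundary of the track, hence so
  -- does their convex combination. At `t = 0` and `t = 1` the respective rescaling is trivial.
  let χ : unitInterval × X × ℝ → ℝ := fun q =>
    (1 - (q.1 : ℝ)) * χ₀ (q.2.2 * ε / tubeRadius ε r q.1) +
      q.1 * χ₁ (q.2.2 * r / tubeRadius ε r q.1)
  have hdiv : ∀ a : ℝ, Continuous fun q : unitInterval × X × ℝ =>
      q.2.2 * a / tubeRadius ε r q.1 := fun a =>
    Continuous.div (by fun_prop) ((continuous_tubeRadius ε r).comp continuous_fst)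
      fun q => hpos q.1
  have hχ : Continuous χ := by
    have h1 := hχ₀.comp (hdiv ε)
    have h2 := hχ₁.comp (hdiv r)
    simp only [Function.comp_def] at h1 h2
    fun_prop
  have hχb : ∀ q ∈ {q : unitInterval × X × ℝ | |q.2.2| ≤ tubeRadius ε r q.1},
      q ∉ Set.range (Subtype.val : TubeTrack X ε r → unitInterval × X × ℝ) →
      (χ q ^ 2 - 1) • (1 : Cl1) = 0 := fun q hq hq' => by
    have : χ q ^ 2 = 1 := by
      rcases eq_or_eq_neg_of_closedTrack hq hq' with h | h
      · simp [χ, h, mul_div_cancel_left₀ _ (hpos _), h₀, h₁]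
      · simp only [χ, h, neg_mul, neg_div, mul_div_cancel_left₀ _ (hpos _), h₀', h₁']
        ring
    rw [this, sub_self, zero_smul]
  obtain ⟨D, hD⟩ :=
    (isCompact_closedTrack (X := X) ε r).exists_bound_of_continuousOn hχ.continuousOn
  let m : TubeTrack X ε r →ᵇ ℝ := BoundedContinuousFunction.ofNormedAddCommGroup
    (fun q => -χ q.1) (by fun_prop) D fun q => by
      rw [norm_neg]
      exact hD q.1 q.2.le
  have hJ := isOpenEmbedding_trackMap hεR hrR hj
  have he : ∀ b, cylinderEquiv Y ((CStarGrading.c0Cl1 Y).cylinder.hom b) =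
      (CStarGrading.c0Cl1 _).hom (cylinderEquiv Y b) := fun b => rfl
  let V : C0Weight (TubeTrack X ε r) := C0Weight.ofBounds _ hW hc hWb
  let p : C(TubeTrack X ε r, X) := ⟨fun q => q.1.2.1, by fun_prop⟩
  let F : C₀(TubeTrack X ε r, Cl1) →ₗ[ℂ] C₀(TubeTrack X ε r, Cl1) :=
    mulOp (BoundedContinuousFunction.const _ Cl1.σ * realMult m)
  have hF : ∀ ψ q, F ψ q = m q • (Cl1.σ * ψ q) := fun ψ q => by simp [F]
  refine ⟨C₀(TubeTrack X ε r, Cl1), inferInstance, inferInstance,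
    weightedModule (cylinderEquiv Y) he hJ V p, F, ?_, ?_, ?_⟩
  · refine weightedModule_isBoundedKKCycle _ he hJ V p m
      (c0Pull (isOpenEmbedding_tubeTrack_val ε r).isEmbedding (isCompact_closedTrack ε r)
        (fun q => q.2.le) (fun q => (χ q ^ 2 - 1) • (1 : Cl1)) (by fun_prop) hχb) (fun q => ?_) F hF
    change _ = ((-χ q.1) ^ 2 - 1) • (1 : Cl1)
    rw [neg_sq]
    rfl
  · refine isEvaluation_track hε hr (by simp [tubeRadius]) hJ V he (fun q => rfl) hF hM₀
      (fun q hq => ?_) (m₀ := fun s => -χ₀ s) hF₀ fun q hq => ?_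
    · rw [C0Weight.ofBounds_root_mul_self, hq]
      simp
    · change -((1 - (q.1.1 : ℝ)) * _ + q.1.1 * _) = _
      rw [hq]
      simp [tubeRadius, hε.ne']
  · refine isEvaluation_track hε hr (by simp [tubeRadius]) hJ V he (fun q => rfl) hF hM₁
      (fun q hq => ?_) (m₀ := fun s => -χ₁ s) hF₁ fun q hq => ?_
    · rw [C0Weight.ofBounds_root_mul_self, hq]
      simp
    · change -((1 - (q.1.1 : ℝ)) * _ + q.1.1 * _) = _
      rw [hq]
      simp [tubeRadius, hr.ne']

end TubeHomotopy

/-! ### Positivity and continuity of the volume ratio. -/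

section VolumeRatio

open Topology Bundle

/-- The Gram determinant changes under a change of frame by a factor independent of the form, which
therefore cancels in a ratio of two such determinants. -/
theorem det_toMatrix_comp_comp {κ W : Type*} [Fintype κ] [DecidableEq κ] [AddCommGroup W]
    [Module ℝ W] (b : Module.Basis κ ℝ W) (B : LinearMap.BilinForm ℝ W) (K : W →ₗ[ℝ] W) :
    ((LinearMap.BilinForm.toMatrix b) (B.comp K K)).det =
      LinearMap.det K ^ 2 * ((LinearMap.BilinForm.toMatrix b) B).det := by
  rw [LinearMap.BilinForm.toMatrix_comp b b B, Matrix.det_mul, Matrix.det_mul, Matrix.det_transpose,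
    LinearMap.det_toMatrix]
  ring

theorem det_toMatrix_pos {κ W : Type*} [Fintype κ] [DecidableEq κ] [AddCommGroup W]
    [Module ℝ W] (b : Module.Basis κ ℝ W) (B : LinearMap.BilinForm ℝ W)
    (hs : ∀ v w, B v w = B w v) (hp : ∀ v, v ≠ 0 → 0 < B v v) :
    0 < ((LinearMap.BilinForm.toMatrix b) B).det :=
  ((LinearMap.BilinForm.posDef_toQuadraticMap_iff_matrix b B ⟨fun v w => hs v w⟩).1
    fun v hv => hp v hv).det_pos

theorem RiemMetric.continuousAt_inner {m : ℕ} {M N : Type*} [TopologicalSpace M]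
    [ChartedSpace (EuclideanSpace ℝ (Fin m)) M] [IsManifold (𝓡 m) ∞ M] (g : RiemMetric m M)
    [TopologicalSpace N] {b : N → M} {v w : ∀ q, TangentSpace (𝓡 m) (b q)} {q : N}
    (hv : ContinuousAt (fun q => (⟨b q, v q⟩ : TangentBundle (𝓡 m) M)) q)
    (hw : ContinuousAt (fun q => (⟨b q, w q⟩ : TangentBundle (𝓡 m) M)) q) :
    ContinuousAt (fun q => g.inner (b q) (v q) (w q)) q := by
  have hf : ContinuousAt b q := by
    simp only [FiberBundle.continuousAt_totalSpace] at hv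
    exact hv.1
  have : ContinuousAt (fun q => TotalSpace.mk' ℝ (E := Bundle.Trivial M ℝ) (b q)
      (g.inner (b q) (v q) (w q))) q := by
    rw [← continuousWithinAt_univ] at hv hw ⊢
    exact (g.contMDiff.continuous.continuousAt.comp_continuousWithinAt
      (continuousWithinAt_univ _ _ |>.2 hf)).clm_bundle_apply₂
      (F₁ := EuclideanSpace ℝ (Fin m)) (F₂ := EuclideanSpace ℝ (Fin m)) hv hw
  simp only [FiberBundle.continuousAt_totalSpace] at this
  exact this.2

/-- The pull-back of the metric of `M` along `f : X × ℝ → M` at `q`, as a bilinear form. -/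
noncomputable def pullbackForm {n m : ℕ} {X M : Type*}
    [TopologicalSpace X] [ChartedSpace (EuclideanSpace ℝ (Fin n)) X]
    [TopologicalSpace M] [ChartedSpace (EuclideanSpace ℝ (Fin m)) M] [IsManifold (𝓡 m) ∞ M]
    (g : RiemMetric m M) (f : X × ℝ → M) (q : X × ℝ) :
    LinearMap.BilinForm ℝ (EuclideanSpace ℝ (Fin n) × ℝ) :=
  let d : EuclideanSpace ℝ (Fin n) × ℝ →L[ℝ] TangentSpace (𝓡 m) (f q) :=
    mfderiv ((𝓡 n).prod 𝓘(ℝ, ℝ)) (𝓡 m) f q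
  LinearMap.mk₂ ℝ (fun v w => g.inner (f q) (d v) (d w))
    (fun v v' w => by simp) (fun c v w => by simp) (fun v w w' => by simp) (fun c v w => by simp)

/-- The standard basis of `ℝⁿ × ℝ`. -/
noncomputable def tubeBasis (n : ℕ) :
    Module.Basis (Fin n ⊕ Unit) ℝ (EuclideanSpace ℝ (Fin n) × ℝ) :=
  (EuclideanSpace.basisFun (Fin n) ℝ).toBasis.prod (Module.Basis.singleton Unit ℝ)

theorem tubeBasis_eq_tubeFrame {n : ℕ} {X : Type*} [TopologicalSpace X]
    [ChartedSpace (EuclideanSpace ℝ (Fin n)) X] (q : X × ℝ) (i : Fin n ⊕ Unit) :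
    tubeBasis n i = (tubeFrame q i : EuclideanSpace ℝ (Fin n) × ℝ) := by
  rcases i with i | i <;> simp [tubeBasis, tubeFrame]

/-- A local diffeomorphism has injective derivative, so the pulled back metric is still positive
definite. -/
theorem det_pullbackForm_pos {n : ℕ} {X Y : Type*} [TopologicalSpace X]
    [ChartedSpace (EuclideanSpace ℝ (Fin n)) X] [TopologicalSpace Y]
    [ChartedSpace (EuclideanSpace ℝ (Fin (n + 1))) Y] [IsManifold (𝓡 (n + 1)) ∞ Y]
    (gY : RiemMetric (n + 1) Y) {f : X × ℝ → Y} {q : X × ℝ}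
    (hf : IsLocalDiffeomorphAt ((𝓡 n).prod 𝓘(ℝ, ℝ)) (𝓡 (n + 1)) ∞ f q) :
    0 < ((LinearMap.BilinForm.toMatrix (tubeBasis n)) (pullbackForm gY f q)).det := by
  refine det_toMatrix_pos _ _ (fun v w => gY.symm _ _ _) fun v hv => ?_
  refine gY.pos _ _ fun h => hv ?_
  exact (hf.mfderivToContinuousLinearEquiv (by simp)).injective (h.trans (map_zero _).symm)

variable {n : ℕ} {X Y : Type*}
  [TopologicalSpace X] [ChartedSpace (EuclideanSpace ℝ (Fin n)) X] [IsManifold (𝓡 n) ∞ X]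

/-- The product metric on `X × ℝ` at `q`, as a bilinear form. -/
noncomputable def productForm (gX : RiemMetric n X) (q : X × ℝ) :
    LinearMap.BilinForm ℝ (EuclideanSpace ℝ (Fin n) × ℝ) :=
  pullbackForm gX Prod.fst q +
    (LinearMap.mul ℝ ℝ).compl₁₂ (LinearMap.snd ℝ _ ℝ) (LinearMap.snd ℝ _ ℝ)

theorem productForm_apply (gX : RiemMetric n X) (q : X × ℝ)
    (v w : EuclideanSpace ℝ (Fin n) × ℝ) :
    productForm gX q v w =
      gX.inner q.1 (v.1 : EuclideanSpace ℝ (Fin n)) (w.1 : EuclideanSpace ℝ (Fin n)) +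
        v.2 * w.2 := by
  change gX.inner q.1 (mfderiv ((𝓡 n).prod 𝓘(ℝ, ℝ)) (𝓡 n) Prod.fst q v)
    (mfderiv ((𝓡 n).prod 𝓘(ℝ, ℝ)) (𝓡 n) Prod.fst q w) + v.2 * w.2 = _
  rw [mfderiv_fst]
  rfl

theorem det_productForm (gX : RiemMetric n X) (q : X × ℝ) :
    ((LinearMap.BilinForm.toMatrix (tubeBasis n)) (productForm gX q)).det =
      (Matrix.of fun i j : Fin n =>
        gX.inner q.1 (EuclideanSpace.single i (1 : ℝ)) (EuclideanSpace.single j (1 : ℝ))).det := by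
  have : (LinearMap.BilinForm.toMatrix (tubeBasis n)) (productForm gX q) =
      Matrix.fromBlocks (Matrix.of fun i j : Fin n =>
        gX.inner q.1 (EuclideanSpace.single i (1 : ℝ)) (EuclideanSpace.single j (1 : ℝ))) 0 0 1 := by
    have h0 : ∀ v, gX.inner q.1 v 0 = 0 := fun v => map_zero _
    have h0' : ∀ v, gX.inner q.1 0 v = 0 := fun v => by rw [gX.symm, h0]
    ext i j
    rw [LinearMap.BilinForm.toMatrix_apply, productForm_apply]
    rcases i with i | i <;> rcases j with j | j
    · simp [tubeBasis]
    · simp [tubeBasis]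
      exact h0 _
    · simp [tubeBasis]
      exact h0' _
    · simp [tubeBasis]
      exact h0 _
  rw [this, Matrix.det_fromBlocks_zero₂₁, Matrix.det_one, mul_one]

theorem det_productForm_pos (gX : RiemMetric n X) (q : X × ℝ) :
    0 < ((LinearMap.BilinForm.toMatrix (tubeBasis n)) (productForm gX q)).det := by
  refine det_toMatrix_pos _ _ (fun v w => ?_) fun v hv => ?_
  · rw [productForm_apply, productForm_apply]
    exact congrArg₂ (· + ·) (gX.symm _ _ _) (mul_comm _ _)
  · rw [productForm_apply]
    by_cases h : v.1 = 0
    · have h2 : v.2 ≠ 0 := fun h2 => hv (Prod.ext h h2)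
      have h3 : gX.inner q.1 (v.1 : EuclideanSpace ℝ (Fin n))
          (v.1 : EuclideanSpace ℝ (Fin n)) = 0 := by
        rw [h]
        exact map_zero _
      rw [h3, zero_add]
      exact mul_self_pos.2 h2
    · have := gX.pos q.1 v.1 h
      nlinarith [mul_self_nonneg v.2]

variable [TopologicalSpace Y] [ChartedSpace (EuclideanSpace ℝ (Fin (n + 1))) Y]
  [IsManifold (𝓡 (n + 1)) ∞ Y]

/-- The unit vector `∂_s` contributes a factor `1`, so the `n × n` determinant of `gX` is that of
the product metric. Both determinants now refer to one basis, as a common change of frame requires.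
-/
theorem volumeRatio_eq (gX : RiemMetric n X) (gY : RiemMetric (n + 1) Y) (ι : X → Y)
    (ν : ∀ x, TangentSpace (𝓡 (n + 1)) (ι x)) (q : X × ℝ) :
    volumeRatio gX gY ι ν q =
      √((LinearMap.BilinForm.toMatrix (tubeBasis n)) (productForm gX q)).det /
      √((LinearMap.BilinForm.toMatrix (tubeBasis n)) (pullbackForm gY (tubeMap gY ι ν) q)).det := by
  have : (LinearMap.BilinForm.toMatrix (tubeBasis n)) (pullbackForm gY (tubeMap gY ι ν) q) =
      Matrix.of fun i j : Fin n ⊕ Unit => gY.inner (tubeMap gY ι ν q)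
        (mfderiv ((𝓡 n).prod 𝓘(ℝ, ℝ)) (𝓡 (n + 1)) (tubeMap gY ι ν) q (tubeFrame q i))
        (mfderiv ((𝓡 n).prod 𝓘(ℝ, ℝ)) (𝓡 (n + 1)) (tubeMap gY ι ν) q (tubeFrame q j)) := by
    ext i j
    rw [LinearMap.BilinForm.toMatrix_apply, tubeBasis_eq_tubeFrame q, tubeBasis_eq_tubeFrame q]
    rfl
  rw [det_productForm, this]
  rfl

section LocalFrame

variable (n : ℕ) {X : Type*} [TopologicalSpace X] [ChartedSpace (EuclideanSpace ℝ (Fin n)) X]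
  [IsManifold (𝓡 n) ∞ X]

/-- The trivialization of the tangent bundle of `X × ℝ` at `q`. -/
noncomputable abbrev tubeTrivialization (q : X × ℝ) :=
  trivializationAt (EuclideanSpace ℝ (Fin n) × ℝ)
    (TangentSpace ((𝓡 n).prod 𝓘(ℝ, ℝ)) : X × ℝ → Type _) q

/-- The frame at `q` obtained from the trivialization of the tangent bundle at `q₀`. -/
noncomputable def localFrame (q₀ q : X × ℝ) :
    EuclideanSpace ℝ (Fin n) × ℝ →L[ℝ] EuclideanSpace ℝ (Fin n) × ℝ :=
  (tubeTrivialization n q₀).symmL ℝ q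

theorem localFrame_det_ne_zero {q₀ q : X × ℝ} (hq : q ∈ (tubeTrivialization n q₀).baseSet) :
    LinearMap.det (localFrame n q₀ q : EuclideanSpace ℝ (Fin n) × ℝ →ₗ[ℝ] _) ≠ 0 := by
  rw [Ne, LinearMap.det_eq_zero_iff_ker_ne_bot, not_not, LinearMap.ker_eq_bot]
  exact Function.LeftInverse.injective
    ((tubeTrivialization n q₀).continuousLinearMapAt_symmL (R := ℝ) hq)

/-- The frame `tubeFrame` is read in the preferred chart at each point, which may jump from point to
point. The frame of a fixed trivialization is a continuous section near `q₀`. -/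
theorem continuousAt_localFrame (q₀ : X × ℝ) (v : EuclideanSpace ℝ (Fin n) × ℝ) :
    ContinuousAt (fun q => (⟨q, localFrame n q₀ q v⟩ :
      TangentBundle ((𝓡 n).prod 𝓘(ℝ, ℝ)) (X × ℝ))) q₀ := by
  have hb := FiberBundle.mem_baseSet_trivializationAt (EuclideanSpace ℝ (Fin n) × ℝ)
    (TangentSpace ((𝓡 n).prod 𝓘(ℝ, ℝ)) : X × ℝ → Type _) q₀
  refine ((tubeTrivialization n q₀).continuousAt_symm_prodMk_left (v := v) hb).congr ?_
  filter_upwards [(tubeTrivialization n q₀).open_baseSet.mem_nhds hb] with q hq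
  exact ((tubeTrivialization n q₀).mk_symm hq v).symm.trans
    (congrArg (TotalSpace.mk q) ((tubeTrivialization n q₀).symmL_apply (R := ℝ) hq v).symm)

theorem continuousAt_pullbackForm_localFrame {m : ℕ} {M : Type*} [TopologicalSpace M]
    [ChartedSpace (EuclideanSpace ℝ (Fin m)) M] [IsManifold (𝓡 m) ∞ M] (g : RiemMetric m M)
    {f : X × ℝ → M} {s : Set (X × ℝ)} (hs : IsOpen s)
    (hf : ContMDiffOn ((𝓡 n).prod 𝓘(ℝ, ℝ)) (𝓡 m) ∞ f s) {q₀ : X × ℝ} (hq₀ : q₀ ∈ s)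
    (v w : EuclideanSpace ℝ (Fin n) × ℝ) :
    ContinuousAt (fun q => pullbackForm g f q (localFrame n q₀ q v) (localFrame n q₀ q w)) q₀ := by
  have key : ∀ v, ContinuousAt (fun q => (⟨f q, mfderiv ((𝓡 n).prod 𝓘(ℝ, ℝ)) (𝓡 m) f q
      (localFrame n q₀ q v)⟩ : TangentBundle (𝓡 m) M)) q₀ := fun v => by
    have h1 := (hf.continuousOn_tangentMapWithin (by simp) hs.uniqueMDiffOn).continuousAt
      (x := (⟨q₀, localFrame n q₀ q₀ v⟩ : TangentBundle ((𝓡 n).prod 𝓘(ℝ, ℝ)) (X × ℝ)))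
      ((hs.preimage (FiberBundle.continuous_proj _ _)).mem_nhds hq₀)
    refine (ContinuousAt.comp (f := fun q => (⟨q, localFrame n q₀ q v⟩ :
      TangentBundle ((𝓡 n).prod 𝓘(ℝ, ℝ)) (X × ℝ))) h1 (continuousAt_localFrame n q₀ v)).congr ?_
    filter_upwards [hs.mem_nhds hq₀] with q hq
    simp only [Function.comp_apply, tangentMapWithin, mfderivWithin_of_isOpen hs hq]
  exact g.continuousAt_inner (key v) (key w)

theorem continuousAt_productForm_localFrame (gX : RiemMetric n X) (q₀ : X × ℝ)
    (v w : EuclideanSpace ℝ (Fin n) × ℝ) :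
    ContinuousAt (fun q => productForm gX q (localFrame n q₀ q v) (localFrame n q₀ q w)) q₀ := by
  -- The `∂_s` component is obtained by the tangent map of `Prod.snd`, whose target is the tangent
  -- bundle of the line.
  have key : ∀ v, ContinuousAt (fun q => (localFrame n q₀ q v).2) q₀ := fun v => by
    have h1 := (contMDiff_snd_tangentBundle_modelSpace (n := 0) ℝ 𝓘(ℝ, ℝ)).continuous
    have h2 : Continuous (tangentMap ((𝓡 n).prod 𝓘(ℝ, ℝ)) 𝓘(ℝ, ℝ) (Prod.snd : X × ℝ → ℝ)) :=
      (contMDiff_snd (n := 1)).continuous_tangentMap le_rfl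
    refine ((h1.comp h2).continuousAt.comp (continuousAt_localFrame n q₀ v)).congr ?_
    filter_upwards with q
    exact congrArg (fun p : TangentBundle 𝓘(ℝ, ℝ) ℝ => (p.2 : ℝ)) (tangentMap_prodSnd
      (p := (⟨q, localFrame n q₀ q v⟩ : TangentBundle ((𝓡 n).prod 𝓘(ℝ, ℝ)) (X × ℝ))))
  exact (continuousAt_pullbackForm_localFrame n gX isOpen_univ
    (contMDiff_fst.contMDiffOn) (Set.mem_univ q₀) v w).add ((key v).mul (key w))

theorem continuousAt_det_localFrame {q₀ : X × ℝ}
    (B : X × ℝ → LinearMap.BilinForm ℝ (EuclideanSpace ℝ (Fin n) × ℝ))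
    (hB : ∀ v w, ContinuousAt (fun q => B q (localFrame n q₀ q v) (localFrame n q₀ q w)) q₀) :
    ContinuousAt (fun q => LinearMap.det (localFrame n q₀ q).toLinearMap ^ 2 *
      ((LinearMap.BilinForm.toMatrix (tubeBasis n)) (B q)).det) q₀ := by
  simp only [← det_toMatrix_comp_comp]
  refine (Continuous.matrix_det continuous_id).continuousAt.comp ?_
  refine continuousAt_pi.2 fun i => continuousAt_pi.2 fun j => ?_
  simp only [LinearMap.BilinForm.toMatrix_apply]
  exact hB _ _

end LocalFrame

theorem volumeRatio_pos {gX : RiemMetric n X} {gY : RiemMetric (n + 1) Y} {ι : X → Y}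
    {ν : ∀ x, TangentSpace (𝓡 (n + 1)) (ι x)} {q : X × ℝ}
    (hf : IsLocalDiffeomorphAt ((𝓡 n).prod 𝓘(ℝ, ℝ)) (𝓡 (n + 1)) ∞ (tubeMap gY ι ν) q) :
    0 < volumeRatio gX gY ι ν q := by
  rw [volumeRatio_eq]
  exact div_pos (Real.sqrt_pos.2 (det_productForm_pos gX q))
    (Real.sqrt_pos.2 (det_pullbackForm_pos gY hf))

/-- Neither Gram determinant in the standard frame need be continuous. Multiplied by the squared
determinant of the local frame both become continuous at `q₀`, and this common factor drops out of
the quotient. -/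
theorem continuousAt_volumeRatio (gX : RiemMetric n X) {gY : RiemMetric (n + 1) Y} {ι : X → Y}
    {ν : ∀ x, TangentSpace (𝓡 (n + 1)) (ι x)} {q₀ : X × ℝ} {s : Set (X × ℝ)} (hs : IsOpen s)
    (hf : ∀ q ∈ s, IsLocalDiffeomorphAt ((𝓡 n).prod 𝓘(ℝ, ℝ)) (𝓡 (n + 1)) ∞ (tubeMap gY ι ν) q)
    (hq₀ : q₀ ∈ s) : ContinuousAt (volumeRatio gX gY ι ν) q₀ := by
  have hb := FiberBundle.mem_baseSet_trivializationAt (EuclideanSpace ℝ (Fin n) × ℝ)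
    (TangentSpace ((𝓡 n).prod 𝓘(ℝ, ℝ)) : X × ℝ → Type _) q₀
  have hsm : ContMDiffOn ((𝓡 n).prod 𝓘(ℝ, ℝ)) (𝓡 (n + 1)) ∞ (tubeMap gY ι ν) s :=
    fun q hq => (hf q hq).contMDiffAt.contMDiffWithinAt
  have h1 := continuousAt_det_localFrame n _ (continuousAt_productForm_localFrame n gX q₀)
  have h2 := continuousAt_det_localFrame n _ fun v w =>
    continuousAt_pullbackForm_localFrame n gY hs hsm hq₀ v w
  have hpos : ∀ q ∈ (tubeTrivialization n q₀).baseSet,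
      0 < LinearMap.det (localFrame n q₀ q).toLinearMap ^ 2 := fun q hq => by
    have := localFrame_det_ne_zero n hq
    positivity
  refine (h1.sqrt.div h2.sqrt ?_).congr ?_
  · exact (Real.sqrt_pos.2 (mul_pos (hpos q₀ hb) (det_pullbackForm_pos gY (hf q₀ hq₀)))).ne'
  · filter_upwards [(tubeTrivialization n q₀).open_baseSet.mem_nhds hb] with q hq
    rw [Pi.div_apply, volumeRatio_eq, Real.sqrt_mul (hpos q hq).le, Real.sqrt_mul (hpos q hq).le,
      mul_div_mul_left _ _ (Real.sqrt_pos.2 (hpos q hq)).ne']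

end VolumeRatio

/-! ### Tube modules over `C₀(Y, Cl1)` and their bounded cycles. -/

section TubeCycles

open Topology BoundedContinuousFunction

section Module

variable {X Y : Type*} [TopologicalSpace X] [T2Space X] [CompactSpace X]
  [TopologicalSpace Y] [T2Space Y]

instance (X : Type*) [TopologicalSpace X] [CompactSpace X] (ε : ℝ) :
    SigmaCompactSpace (X × Set.Ioo (-ε) ε) :=
  have : LocallyCompactSpace (Set.Ioo (-ε) ε) := isOpen_Ioo.locallyCompactSpace
  inferInstance

instance (X : Type*) [TopologicalSpace X] [T2Space X] [CompactSpace X] (ε : ℝ) :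
    LocallyCompactSpace (X × Set.Ioo (-ε) ε) :=
  have : LocallyCompactSpace (Set.Ioo (-ε) ε) := isOpen_Ioo.locallyCompactSpace
  inferInstance

/-- The Hilbert module of functions on the tube of radius `ε` with weight `V`. -/
noncomputable def tubeModule {j : X × ℝ → Y} {ε : ℝ}
    (hj : IsOpenEmbedding fun q : X × Set.Ioo (-ε) ε => j (q.1, q.2))
    (V : C0Weight (X × Set.Ioo (-ε) ε)) :
    GradedBimodule (CStarGrading.trivial C(X, ℂ)) (CStarGrading.c0Cl1 Y) (TubeSections X ε) :=
  weightedModule (StarAlgEquiv.refl (R := ℂ) (A := C₀(Y, Cl1))) (fun _ => rfl) hj V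
    ⟨Prod.fst, continuous_fst⟩

theorem isTubeModule_tubeModule {j : X × ℝ → Y} {ε : ℝ}
    (hj : IsOpenEmbedding fun q : X × Set.Ioo (-ε) ε => j (q.1, q.2))
    (V : C0Weight (X × Set.Ioo (-ε) ε)) {w : X × ℝ → ℝ}
    (hw : ∀ q : X × Set.Ioo (-ε) ε, V.root q * V.root q = w (q.1, q.2)) :
    IsTubeModule j w ε (tubeModule hj V) where
  left g ψ p := pullMul_apply _ _ _ _
  act ψ h p := mul_comm _ _
  grade ψ p := rfl
  inner ψ φ p := by
    rw [← hw]
    exact weightedModule_inner_apply (β := CStarGrading.c0Cl1 Y)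
      (StarAlgEquiv.refl (R := ℂ) (A := C₀(Y, Cl1))) (fun _ => rfl) hj V
      (⟨Prod.fst, continuous_fst⟩ : C(X × Set.Ioo (-ε) ε, X)) ψ φ p
  inner_off ψ φ y hy := weightedModule_inner_apply_of_forall_ne
    (β := CStarGrading.c0Cl1 Y) (StarAlgEquiv.refl (R := ℂ) (A := C₀(Y, Cl1))) (fun _ => rfl) hj V
    (⟨Prod.fst, continuous_fst⟩ : C(X × Set.Ioo (-ε) ε, X)) ψ φ hy

/-- Because `χ(±r) = ±1`, the function `χ ^ 2 - 1` vanishes on the boundary of the tube and so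
belongs to `C₀` of its interior. -/
theorem isBoundedKKCycle_tubeModule {j : X × ℝ → Y} {r : ℝ}
    (hj : IsOpenEmbedding fun q : X × Set.Ioo (-r) r => j (q.1, q.2))
    (V : C0Weight (X × Set.Ioo (-r) r)) {χ : ℝ → ℝ} (hχ : Continuous χ) (h : χ r = 1)
    (h' : χ (-r) = -1) {F : TubeSections X r →ₗ[ℂ] TubeSections X r}
    (hF : ∀ ψ p, F ψ p = (-χ p.2) • (Cl1.σ * ψ p)) :
    (tubeModule hj V).IsBoundedKKCycle F := by
  obtain ⟨D, hD⟩ := (isCompact_Icc (a := -r) (b := r)).exists_bound_of_continuousOn hχ.continuousOn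
  refine weightedModule_isBoundedKKCycle _ _ hj V _
    (BoundedContinuousFunction.ofNormedAddCommGroup (fun q => -χ q.2) (by fun_prop) D fun q => by
      rw [norm_neg]
      exact hD q.2 (Set.Ioo_subset_Icc_self q.2.2))
    (c0Pull (isOpenEmbedding_tubeIncl X r).isEmbedding (isCompact_closedTube r)
      (fun q => (abs_lt.2 q.2.2).le) (fun q => (χ q.2 ^ 2 - 1) • (1 : Cl1)) (by fun_prop)
      fun q hq hq' => ?_) (fun q => ?_) F hF
  · rw [mem_range_tubeIncl, not_lt] at hq'
    have : χ q.2 ^ 2 = 1 := by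
      rcases eq_or_eq_neg_of_abs_eq (le_antisymm hq hq') with hs | hs
      · rw [hs, h, one_pow]
      · rw [hs, h', neg_one_sq]
    rw [this, sub_self, zero_smul]
  · change (χ q.2 ^ 2 - 1) • (1 : Cl1) = ((-χ q.2) ^ 2 - 1) • (1 : Cl1)
    rw [neg_sq]

/-- The function `1` as a weight. -/
noncomputable def C0Weight.one (P : Type*) [TopologicalSpace P] : C0Weight P :=
  ⟨1, 1, fun _ => one_mul 1⟩

/-- Multiplication by `-χ σ` on the tube. -/
theorem exists_tubeOperator (X : Type*) [TopologicalSpace X] (r : ℝ) {χ : ℝ → ℝ}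
    (hχ : Continuous χ) : ∃ F : TubeSections X r →ₗ[ℂ] TubeSections X r,
      ∀ ψ p, F ψ p = (-χ p.2) • (Cl1.σ * ψ p) := by
  obtain ⟨D, hD⟩ := (isCompact_Icc (a := -r) (b := r)).exists_bound_of_continuousOn hχ.continuousOn
  let m : X × Set.Ioo (-r) r →ᵇ ℝ :=
    BoundedContinuousFunction.ofNormedAddCommGroup (fun q => -χ q.2) (by fun_prop) D fun q => by
      rw [norm_neg]
      exact hD q.2 (Set.Ioo_subset_Icc_self q.2.2)
  exact ⟨mulOp (BoundedContinuousFunction.const _ Cl1.σ * realMult m), fun ψ p => by simp [m]⟩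

end Module

/-! ### The tangent profile and its bounded transform. -/

section TanProfile

theorem tanProfile_denom_pos {c : ℝ} (hc : c ≠ 0) (θ : ℝ) :
    0 < Real.cos θ ^ 2 + c ^ 2 * Real.sin θ ^ 2 := by
  have h := Real.sin_sq_add_cos_sq θ
  by_cases h0 : Real.cos θ = 0
  · rw [h0] at h ⊢
    have : 0 < c ^ 2 := by positivity
    nlinarith
  · have : 0 < Real.cos θ ^ 2 := by positivity
    have := mul_nonneg (sq_nonneg c) (sq_nonneg (Real.sin θ))
    linarith

/-- The function `(1 + f ^ 2)^(1/2) cos` for the profile `f`, continued to the line. -/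
noncomputable def tanDenom (ε s : ℝ) : ℝ :=
  √(Real.cos (Real.pi * s / (2 * ε)) ^ 2 +
    (Real.pi / (2 * ε)) ^ 2 * Real.sin (Real.pi * s / (2 * ε)) ^ 2)

theorem tanDenom_pos {ε : ℝ} (hε : 0 < ε) (s : ℝ) : 0 < tanDenom ε s :=
  Real.sqrt_pos.2 (tanProfile_denom_pos (by positivity) _)

theorem continuous_tanDenom (ε : ℝ) : Continuous (tanDenom ε) := by
  unfold tanDenom
  fun_prop

/-- Minus the bounded transform of the profile, continued to the line. -/
noncomputable def tanTransform (ε s : ℝ) : ℝ :=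
  Real.pi / (2 * ε) * Real.sin (Real.pi * s / (2 * ε)) / tanDenom ε s

theorem continuous_tanTransform {ε : ℝ} (hε : 0 < ε) : Continuous (tanTransform ε) :=
  Continuous.div (by fun_prop) (continuous_tanDenom ε) fun s => (tanDenom_pos hε s).ne'

theorem tanTransform_self {ε : ℝ} (hε : 0 < ε) : tanTransform ε ε = 1 := by
  have h : Real.pi * ε / (2 * ε) = Real.pi / 2 := by field_simp
  rw [tanTransform, tanDenom, h, Real.sin_pi_div_two, Real.cos_pi_div_two, one_pow, mul_one,
    mul_one, zero_pow two_ne_zero, zero_add, Real.sqrt_sq (by positivity),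
    div_self (by positivity)]

theorem tanTransform_neg_self {ε : ℝ} (hε : 0 < ε) : tanTransform ε (-ε) = -1 := by
  have h : tanTransform ε (-ε) = -tanTransform ε ε := by
    simp only [tanTransform, tanDenom, mul_neg, neg_div, Real.sin_neg, Real.cos_neg, neg_sq]
  rw [h, tanTransform_self hε]

theorem cos_pos_of_mem_Ioo {ε s : ℝ} (hε : 0 < ε) (hs : s ∈ Set.Ioo (-ε) ε) :
    0 < Real.cos (Real.pi * s / (2 * ε)) := by
  have hπ := Real.pi_pos
  refine Real.cos_pos_of_mem_Ioo ⟨?_, ?_⟩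
  · rw [lt_div_iff₀ (by positivity)]
    nlinarith [hs.1]
  · rw [div_lt_iff₀ (by positivity)]
    nlinarith [hs.2]

/-- Clearing `cos ^ 2` from `1 + f ^ 2` leaves a denominator without zeros, so the right-hand side
is continuous on the whole line and visibly zero at `±ε`. -/
theorem sqrt_one_add_tanProfile_sq {ε s : ℝ} (hε : 0 < ε) (hs : s ∈ Set.Ioo (-ε) ε) :
    (√(1 + tanProfile ε s ^ 2))⁻¹ = Real.cos (Real.pi * s / (2 * ε)) / tanDenom ε s := by
  have hc := cos_pos_of_mem_Ioo hε hs
  have h : 1 + tanProfile ε s ^ 2 = (Real.cos (Real.pi * s / (2 * ε)) ^ 2 +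
      (Real.pi / (2 * ε)) ^ 2 * Real.sin (Real.pi * s / (2 * ε)) ^ 2) /
      Real.cos (Real.pi * s / (2 * ε)) ^ 2 := by
    rw [tanProfile, Real.tan_eq_sin_div_cos, add_div, div_self (by positivity)]
    ring
  rw [h, Real.sqrt_div' _ (by positivity), Real.sqrt_sq hc.le, inv_div]
  rfl

theorem isMaximalMul_immersionOperator (X : Type*) [TopologicalSpace X] [CompactSpace X] {ε : ℝ}
    (hε : 0 < ε) : IsMaximalMul (immersionOperator X ε) (fun q => tanProfile ε q.2) where
  continuous := by
    refine continuous_iff_continuousAt.2 fun q => ?_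
    refine ContinuousAt.mul continuousAt_const ?_
    exact ContinuousAt.comp (f := fun q : X × Set.Ioo (-ε) ε => Real.pi * (q.2 : ℝ) / (2 * ε))
      (Real.continuousAt_tan.2 (cos_pos_of_mem_Ioo hε q.2.2).ne') (by fun_prop)
  mem_domain ψ φ h := ⟨φ, h⟩
  apply ψ q := immersionOperator_apply ψ q
  proper δ hδ := by
    have hcont : Continuous fun q : X × ℝ =>
        (Real.cos (Real.pi * q.2 / (2 * ε)) / tanDenom ε q.2) • (1 : Cl1) := by
      refine Continuous.smul (Continuous.div (by fun_prop)
        ((continuous_tanDenom ε).comp continuous_snd) fun q => (tanDenom_pos hε _).ne')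
        continuous_const
    have h0 : ∀ q ∈ {q : X × ℝ | |q.2| ≤ ε}, q ∉ Set.range (tubeIncl X ε) →
        (Real.cos (Real.pi * q.2 / (2 * ε)) / tanDenom ε q.2) • (1 : Cl1) = 0 := fun q hq hq' => by
      rw [mem_range_tubeIncl, not_lt] at hq'
      have h1 : Real.pi * ε / (2 * ε) = Real.pi / 2 := by field_simp
      have h2 : Real.cos (Real.pi * q.2 / (2 * ε)) = 0 := by
        rcases eq_or_eq_neg_of_abs_eq (le_antisymm hq hq') with hs | hs
        · rw [hs, h1, Real.cos_pi_div_two]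
        · rw [hs, mul_neg, neg_div, Real.cos_neg, h1, Real.cos_pi_div_two]
      rw [h2, zero_div, zero_smul]
    obtain ⟨K, hK, h⟩ := (c0Pull (isOpenEmbedding_tubeIncl X ε).isEmbedding (isCompact_closedTube ε)
      (fun q => (abs_lt.2 q.2.2).le) _ hcont h0).exists_isCompact_norm_lt hδ
    refine ⟨K, hK, fun q hq => ?_⟩
    have h3 : ‖(Real.cos (Real.pi * q.2 / (2 * ε)) / tanDenom ε q.2) • (1 : Cl1)‖ < δ := h q hq
    rw [norm_smul, norm_one, mul_one, Real.norm_eq_abs] at h3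
    rw [sqrt_one_add_tanProfile_sq hε q.2.2]
    exact (le_abs_self _).trans_lt h3

theorem transform_immersionOperator_apply {X : Type*} [TopologicalSpace X] [CompactSpace X] {ε : ℝ}
    (hε : 0 < ε) (ψ : TubeSections X ε) (p : X × Set.Ioo (-ε) ε) :
    (isMaximalMul_immersionOperator X hε).transform ψ p =
      (-tanTransform ε p.2) • (Cl1.σ * ψ p) := by
  rw [IsMaximalMul.transform_apply, IsMaximalMul.bdd_apply, IsMaximalMul.decay_apply,
    sqrt_one_add_tanProfile_sq hε p.2.2]
  congr 1
  have hc := (cos_pos_of_mem_Ioo hε p.2.2).ne'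
  have hd := (tanDenom_pos hε p.2).ne'
  rw [tanProfile, tanTransform, Real.tan_eq_sin_div_cos]
  field_simp

end TanProfile

/-! ### Consequences of the tubular radius condition. -/

section Geometry

variable {n : ℕ} {X Y : Type*}
    [TopologicalSpace X] [ChartedSpace (EuclideanSpace ℝ (Fin n)) X]
    [TopologicalSpace Y] [ChartedSpace (EuclideanSpace ℝ (Fin (n + 1))) Y]
    [IsManifold (𝓡 (n + 1)) ∞ Y] {gY : RiemMetric (n + 1) Y}
    {ι : X → Y} {ν : ∀ x, TangentSpace (𝓡 (n + 1)) (ι x)} {ε₀ : ℝ}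

theorem IsTubularRadius.isLocalDiffeomorphAt (h : IsTubularRadius gY ι ν ε₀) {q : X × ℝ}
    (hq : |q.2| < ε₀) :
    IsLocalDiffeomorphAt ((𝓡 n).prod 𝓘(ℝ, ℝ)) (𝓡 (n + 1)) ∞ (tubeMap gY ι ν) q := by
  obtain ⟨-, -, Φ, hs, hΦ⟩ := h
  exact ⟨Φ, by rw [hs]; exact ⟨trivial, abs_lt.1 hq⟩, hΦ⟩

theorem IsTubularRadius.isOpenEmbedding (h : IsTubularRadius gY ι ν ε₀) :
    IsOpenEmbedding fun q : X × Set.Ioo (-ε₀) ε₀ => tubeMap gY ι ν (q.1, q.2) := by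
  obtain ⟨-, -, Φ, hs, hΦ⟩ := h
  have hmem : ∀ q : X × Set.Ioo (-ε₀) ε₀, ((q.1, q.2) : X × ℝ) ∈ Φ.source := fun q => by
    rw [hs]
    exact ⟨trivial, q.2.2⟩
  have h1 : IsOpenEmbedding fun q : X × Set.Ioo (-ε₀) ε₀ =>
      (⟨(q.1, q.2), hmem q⟩ : Φ.source) :=
    IsOpenEmbedding.of_comp _ Φ.open_source.isOpenEmbedding_subtypeVal
      (isOpenEmbedding_tubeIncl X ε₀)
  have h2 := Φ.toOpenPartialHomeomorph.isOpenEmbedding_restrict.comp h1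
  convert h2 using 1
  funext q
  exact hΦ (hmem q)

variable [IsManifold (𝓡 n) ∞ X]

theorem IsTubularRadius.continuousOn_volumeRatio (h : IsTubularRadius gY ι ν ε₀)
    (gX : RiemMetric n X) : ContinuousOn (volumeRatio gX gY ι ν) {q | |q.2| < ε₀} :=
  fun q (hq : |q.2| < ε₀) =>
  (continuousAt_volumeRatio gX (isOpen_lt (f := fun q : X × ℝ => |q.2|) (by fun_prop)
    continuous_const)
    (fun _ hq => h.isLocalDiffeomorphAt hq) hq).continuousWithinAt

theorem IsTubularRadius.exists_volumeRatio_bounds [CompactSpace X] (h : IsTubularRadius gY ι ν ε₀)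
    (gX : RiemMetric n X) {R : ℝ} (hR : R < ε₀) :
    ∃ c C : ℝ, 0 < c ∧ c ≤ 1 ∧ 1 ≤ C ∧ ∀ q : X × ℝ, |q.2| < R →
      c ≤ volumeRatio gX gY ι ν q ∧ volumeRatio gX gY ι ν q ≤ C := by
  have hsub : {q : X × ℝ | |q.2| ≤ R} ⊆ {q | |q.2| < ε₀} := fun q hq => lt_of_le_of_lt hq hR
  have hpos : ∀ q : X × ℝ, |q.2| < ε₀ → 0 < volumeRatio gX gY ι ν q := fun q hq =>
    volumeRatio_pos (h.isLocalDiffeomorphAt hq)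
  have hw := (h.continuousOn_volumeRatio gX).mono hsub
  obtain ⟨C, hC⟩ := (isCompact_closedTube (X := X) R).exists_bound_of_continuousOn hw
  obtain ⟨D, hD⟩ := (isCompact_closedTube (X := X) R).exists_bound_of_continuousOn
    (hw.inv₀ fun q hq => (hpos q (hsub hq)).ne')
  -- The lower bound comes from bounding the inverse of the ratio. The maxima with `1` make the same
  -- constants valid for the weight `1` of the shriek module.
  refine ⟨(max D 1)⁻¹, max C 1, by positivity, inv_le_one_of_one_le₀ (le_max_right _ _),
    le_max_right _ _, fun q hq => ⟨?_, ?_⟩⟩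
  · have hp := hpos q (hq.trans hR)
    have := (le_abs_self _).trans (hD q hq.le)
    exact inv_le_of_inv_le₀ hp (this.trans (le_max_left _ _))
  · exact ((le_abs_self _).trans (hC q hq.le)).trans (le_max_left _ _)

end Geometry

end TubeCycles

theorem mainTheorem6 {n : ℕ} {X Y : Type*}
    [TopologicalSpace X] [ChartedSpace (EuclideanSpace ℝ (Fin n)) X] [IsManifold (𝓡 n) ∞ X]
    [T2Space X] [CompactSpace X]
    [TopologicalSpace Y] [ChartedSpace (EuclideanSpace ℝ (Fin (n + 1))) Y]
    [IsManifold (𝓡 (n + 1)) ∞ Y] [T2Space Y] [SecondCountableTopology Y]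
    (gX : RiemMetric n X) (gY : RiemMetric (n + 1) Y)
    (ι : X → Y) (hι : IsRiemannianEmbedding gX gY ι)
    (ν : ∀ x, TangentSpace (𝓡 (n + 1)) (ι x)) (hν : IsUnitNormal gY ι ν)
    (ε₀ : ℝ) (hε₀ : IsTubularRadius gY ι ν ε₀)
    (ε : ℝ) (hε : 0 < ε) (hεε₀ : ε < ε₀) :
    ∃ M : GradedBimodule (CStarGrading.trivial C(X, ℂ)) (CStarGrading.c0Cl1 Y)
        (TubeSections X ε),
      IsTubeModule (tubeMap gY ι ν) (volumeRatio gX gY ι ν) ε M ∧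
      M.IsSelfAdjointOp (immersionOperator X ε) ∧
      M.IsRegularOp (immersionOperator X ε) ∧
      M.HasCompactResolvent (immersionOperator X ε) ∧
      M.IsUnboundedKKCycle (immersionOperator X ε) ∧
      ∃ F : TubeSections X ε →ₗ[ℂ] TubeSections X ε,
        M.IsBoundedTransform (immersionOperator X ε) F ∧
        M.IsBoundedKKCycle F ∧
        ∀ (r : ℝ) (χ : ℝ → ℝ), 0 < r → r < ε₀ → ContinuousOn χ (Set.Icc (-r) r) →
          χ (-r) = -1 → χ r = 1 →
          ∃ (M' : GradedBimodule (CStarGrading.trivial C(X, ℂ)) (CStarGrading.c0Cl1 Y)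
              (TubeSections X r)) (F' : TubeSections X r →ₗ[ℂ] TubeSections X r),
            IsShriekCycle (tubeMap gY ι ν) r χ M' F' ∧ SameKKClass M F M' F' := by
  -- Needed for σ-compactness of the track of the homotopy.
  have : SecondCountableTopology X :=
    ChartedSpace.secondCountable_of_sigmaCompact (EuclideanSpace ℝ (Fin n)) X
  have hj := hε₀.isOpenEmbedding
  obtain ⟨c, C, hc, -, -, hb⟩ := hε₀.exists_volumeRatio_bounds gX hεε₀
  have hS := isMaximalMul_immersionOperator X hε
  have hjε := isOpenEmbedding_tube_of_le hεε₀.le hj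
  have hq : ∀ q : X × Set.Ioo (-ε) ε, |(q.2 : ℝ)| < ε := fun q => abs_lt.2 q.2.2
  have hcont : Continuous fun q : X × Set.Ioo (-ε) ε => volumeRatio gX gY ι ν (q.1, q.2) :=
    (hε₀.continuousOn_volumeRatio gX).comp_continuous (by fun_prop) fun q => (hq q).trans hεε₀
  let V := C0Weight.ofBounds _ hcont hc fun q => hb _ (hq q)
  have hM : IsTubeModule (tubeMap gY ι ν) (volumeRatio gX gY ι ν) ε (tubeModule hjε V) :=
    isTubeModule_tubeModule hjε V (C0Weight.ofBounds_root_mul_self _ hcont hc _)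
  refine ⟨tubeModule hjε V, hM, hS.isSelfAdjointOp _ _ _ _ _, hS.isRegularOp _ _ _ _ _,
    hS.hasCompactResolvent _ _ _ _ _, hS.isUnboundedKKCycle _ _ _ _ _, hS.transform,
    hS.isBoundedTransform _ _ _ _ _, hS.isBoundedKKCycle_transform _ _ _ _ _,
    fun r χ hr hrε₀ hχ hχ₀ hχ₁ => ?_⟩
  have hle : -r ≤ r := by linarith
  -- Outside `[-r, r]` nothing is known about `χ`; it is replaced by its constant continuation.
  obtain ⟨χ', hχ'c, hχ'⟩ : ∃ χ' : ℝ → ℝ, Continuous χ' ∧ ∀ s ∈ Set.Icc (-r) r, χ' s = χ s :=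
    ⟨Set.IccExtend hle fun s => χ s, (continuousOn_iff_continuous_domRestrict.1 hχ).Icc_extend',
      fun s hs => Set.IccExtend_of_mem hle _ hs⟩
  have h1 : χ' r = 1 := (hχ' r ⟨hle, le_rfl⟩).trans hχ₁
  have h1' : χ' (-r) = -1 := (hχ' (-r) ⟨le_rfl, hle⟩).trans hχ₀
  have hjr := isOpenEmbedding_tube_of_le hrε₀.le hj
  have hM' : IsTubeModule (tubeMap gY ι ν) (fun _ => 1) r (tubeModule hjr (C0Weight.one _)) :=
    isTubeModule_tubeModule hjr _ fun q => one_mul 1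
  obtain ⟨F', hF'⟩ := exists_tubeOperator X r hχ'c
  refine ⟨tubeModule hjr (C0Weight.one _), F', ⟨hM', fun ψ p => ?_,
    isBoundedKKCycle_tubeModule hjr _ hχ'c h1 h1' hF'⟩, ?_⟩
  · rw [hF', hχ' _ (Set.Ioo_subset_Icc_self p.2.2)]
  -- The ratio need not be bounded up to radius `ε₀`, so the homotopy takes place in a tube of
  -- radius strictly between both radii and `ε₀`.
  · obtain ⟨R, hR, hRε₀⟩ := exists_between (max_lt hεε₀ hrε₀)
    obtain ⟨c, C, hc, hc1, hC1, hb⟩ := hε₀.exists_volumeRatio_bounds gX hRε₀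
    exact sameKKClass_tube hε hr ((le_max_left _ _).trans_lt hR) ((le_max_right _ _).trans_lt hR)
      (isOpenEmbedding_tube_of_le hRε₀.le hj)
      ((hε₀.continuousOn_volumeRatio gX).mono fun q hq => hq.trans hRε₀) continuousOn_const hc hb
      (fun _ _ => ⟨hc1, hC1⟩) (continuous_tanTransform hε) hχ'c (tanTransform_self hε)
      (tanTransform_neg_self hε) h1 h1' hM hM' (transform_immersionOperator_apply hε) hF'
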